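/- Let $(S,A,P,r,\gamma)$ be a discounted Markov decision process: $S$ is a measurable space (for instance a Borel subset of $\mathbb R^m$), $A$ is a countable discrete action space, $P$ is a probability kernel from $S\times A$ to $S$, $r:S\times A\to\mathbb R$ is bounded and measurable, and $\gamma\in(0,1)$. A policy is a probability kernel from $S$ to $A$; fix a reference policy $\pi^{\rm ref}$. For a policy $\pi$, let $\zeta^\pi_{x,a}$ be the law of $\sum_{t\ge 0}\gamma^t r(X_t,A_t)$, where $(X_0,A_0)=(x,a)$, $X_{t+1}\sim P_{X_t,A_t}$ and $A_{t+1}\sim\pi_{X_{t+1}}$. Let $q^\pi(x,a)$ be the mean of $\zeta^\pi_{x,a}$ and let $q^\star=\sup_\pi q^\pi$. For $\tau>0$ and bounded measurable $q:S\times A\to\mathbb R$ put $$(V_\tau q)(x)=\tau\log\int e^{q(x,a)/\tau}\,d\pi^{\rm ref}_x(a),\qquad d(B_\tau q)_x(a)=e^{(q(x,a)-(V_\tau q)(x))/\tau}\,d\pi^{\rm ref}_x(a).$$ Let $q^\star_\tau$ be the unique bounded measurable solution of $q(x,a)=r(x,a)+\gamma\int V_\tau q\,dP_{x,a}$, and let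 $\bar q^\star$ be the unique bounded measurable solution of $q(x,a)=r(x,a)+\gamma\int \operatorname{ess\,sup}_{\pi^{\rm ref}_{x'}}q(x',\cdot)\,dP_{x,a}(x')$. For $q:S\times A\to\mathbb R$ write $O_q(x)=\{a\in A: q(x,a)=\operatorname{ess\,sup}_{\pi^{\rm ref}_x}q(x,\cdot)\}$. Let $\bar\pi^\star_x$ be $\pi^{\rm ref}_x$ restricted to $O_{\bar q^\star}(x)$ and normalized to a probability measure. Assume that there is $p_{\min}>0$ with $\pi^{\rm ref}_x(O_{q^\star_\tau}(x))\ge p_{\min}$ for all $\tau>0$ and all $x\in S$. Let $\sigma=\sigma(\tau)>0$ be such that $\sigma(\tau)/\tau\to0$ as $\tau\downarrow0$, and let $\zeta^{\tau,\sigma}$ be the return distribution function of the decoupled policy $\pi^{\tau,\sigma}=B_\tau q^\star_{\sigma}$. Then, for all $p,p'\in[1,\infty)$ and every probability measure $\omega$ on $S\times A$, $$\left(\int w_p\big(\zeta^{\tau,\sigma(\tau)}_{x,a},\zeta^{\bar\pi^\star}_{x,a}\big)^{p'}\,d\omega(x,a)\right)^{1/p'}\longrightarrow 0\qquad\text{as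 }\tau\downarrow0,$$ where $w_p$ is the $p$-Wasserstein distance on $\mathbb R$. Moreover, if $q^\star=\bar q^\star$, the same convergence holds with $\bar\pi^\star$ replaced by the policy obtained by restricting $\pi^{\rm ref}_x$ to $O_{q^\star}(x)$ and normalizing. -/

import Mathlib

open MeasureTheory ProbabilityTheory Filter Topology
open scoped ENNReal

noncomputable section

/-- A discounted Markov decision process with state space `S` and action space `A`: a transition
probability kernel `P`, a bounded measurable reward `r`, and a discount factor `γ ∈ (0, 1)`. -/
structure MDP (S A : Type*) [MeasurableSpace S] [MeasurableSpace A] where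
  P : Kernel (S × A) S
  isMarkov : IsMarkovKernel P
  r : S × A → ℝ
  measurable_r : Measurable r
  bounded_r : ∃ C : ℝ, ∀ z, |r z| ≤ C
  γ : ℝ
  γ_pos : 0 < γ
  γ_lt_one : γ < 1

namespace MDP

variable {S A : Type*} [MeasurableSpace S] [MeasurableSpace A]

instance (M : MDP S A) : IsMarkovKernel M.P := M.isMarkov

/-! ### Trajectories and return distributions -/

/-- The state-action transition kernel of a policy `π`: from `(x, a)`, draw `x'` from `P (x, a)`
and then `a'` from `π x'`. -/
def stepKernel (M : MDP S A) (π : Kernel S A) : Kernel (S × A) (S × A) :=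
  M.P ⊗ₖ (π.prodMkLeft (S × A))

instance (M : MDP S A) (π : Kernel S A) [IsMarkovKernel π] : IsMarkovKernel (M.stepKernel π) := by
  unfold stepKernel; infer_instance

/-- The transition kernel of `π` seen as a kernel from the history up to time `n`. -/
def historyKernel (M : MDP S A) (π : Kernel S A) (n : ℕ) :
    Kernel ((i : Finset.Iic n) → S × A) (S × A) :=
  (M.stepKernel π).comap (fun h => h ⟨n, Finset.mem_Iic.2 le_rfl⟩) (measurable_pi_apply _)

instance (M : MDP S A) (π : Kernel S A) [IsMarkovKernel π] (n : ℕ) :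
    IsMarkovKernel (M.historyKernel π n) := by
  unfold historyKernel; infer_instance

/-- The law of the whole state-action sequence `(X_t, A_t)_{t ≥ 0}` under `π`, given
`(X_0, A_0) = (x, a)`. -/
def trajKernel (M : MDP S A) (π : Kernel S A) [IsMarkovKernel π] :
    Kernel (S × A) (ℕ → S × A) :=
  (Kernel.traj (X := fun _ => S × A) (M.historyKernel π) 0).comap (fun z _ => z)
    (measurable_pi_lambda _ fun _ => measurable_id)

/-- The discounted return of a trajectory. -/
def discountedReturn (M : MDP S A) (ω : ℕ → S × A) : ℝ :=
  ∑' t : ℕ, M.γ ^ t * M.r (ω t)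

/-- The return distribution function `ζ^π`. -/
def returnDist (M : MDP S A) (π : Kernel S A) [IsMarkovKernel π] : Kernel (S × A) ℝ :=
  (M.trajKernel π).map M.discountedReturn

/-- The action-value function `q^π`, the mean of `ζ^π`. -/
def qValue (M : MDP S A) (π : Kernel S A) [IsMarkovKernel π] (z : S × A) : ℝ :=
  ∫ g, g ∂(M.returnDist π z)

/-- The (classical) optimal action-value function `q^⋆`, the supremum of `q^π` over all
policies. -/
def qStar (M : MDP S A) (z : S × A) : ℝ :=
  ⨆ π : {π : Kernel S A // IsMarkovKernel π}, haveI := π.2; M.qValue π.1 z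

/-! ### Bellman operators -/

/-- `(V_τ q)(x) = τ log ∫ exp (q (x, a) / τ) dπref_x(a)`. -/
def vLSE (πref : Kernel S A) (τ : ℝ) (q : S × A → ℝ) (x : S) : ℝ :=
  τ * Real.log (∫ a, Real.exp (q (x, a) / τ) ∂(πref x))

/-- The soft Bellman optimality operator at temperature `τ`. -/
def softBellman (M : MDP S A) (πref : Kernel S A) (τ : ℝ) (q : S × A → ℝ) (z : S × A) : ℝ :=
  M.r z + M.γ * ∫ x', vLSE πref τ q x' ∂(M.P z)

/-- The Bellman reference-optimality operator. -/
def refBellman (M : MDP S A) (πref : Kernel S A) (q : S × A → ℝ) (z : S × A) : ℝ :=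
  M.r z + M.γ * ∫ x', essSup (fun a => q (x', a)) (πref x') ∂(M.P z)

/-- `q` is a fixed point of `T` in the space of bounded measurable functions. -/
def IsBddFixedPoint (T : (S × A → ℝ) → S × A → ℝ) (q : S × A → ℝ) : Prop :=
  Measurable q ∧ (∃ C : ℝ, ∀ z, |q z| ≤ C) ∧ T q = q

/-- `q^⋆_τ`, the (unique) bounded measurable fixed point of the soft Bellman optimality
operator. -/
def qSoft (M : MDP S A) (πref : Kernel S A) (τ : ℝ) : S × A → ℝ :=
  Classical.epsilon (IsBddFixedPoint (M.softBellman πref τ))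

/-- The reference-optimal action-value function, the (unique) bounded measurable fixed point of
the Bellman reference-optimality operator. -/
def qRef (M : MDP S A) (πref : Kernel S A) : S × A → ℝ :=
  Classical.epsilon (IsBddFixedPoint (M.refBellman πref))

/-! ### Policies -/

/-- Makes a kernel `κ` a total policy: equal to `κ x` wherever `κ x` is a probability measure.
The value `πref x` elsewhere is a convention. -/
def toPolicy (πref κ : Kernel S A) : Kernel S A :=
  open Classical in
  Kernel.piecewise (s := (fun x => κ x Set.univ) ⁻¹' {1})
    (κ.measurable_coe MeasurableSet.univ (measurableSet_singleton 1)) κ πref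

instance (πref κ : Kernel S A) [IsMarkovKernel πref] : IsMarkovKernel (toPolicy πref κ) := by
  refine ⟨fun x => ⟨?_⟩⟩
  classical
  unfold toPolicy
  rw [Kernel.piecewise_apply']
  split_ifs with h
  · exact h
  · exact measure_univ

/-- The Boltzmann–Gibbs policy with potential `q` and temperature `τ`, which has density
`exp ((q (x, a) - (V_τ q)(x)) / τ)` with respect to `πref x`. -/
def boltzmann (πref : Kernel S A) [IsMarkovKernel πref] (τ : ℝ) (q : S × A → ℝ) : Kernel S A :=
  toPolicy πref
    (πref.withDensity fun x a => ENNReal.ofReal (Real.exp ((q (x, a) - vLSE πref τ q x) / τ)))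

instance (πref : Kernel S A) [IsMarkovKernel πref] (τ : ℝ) (q : S × A → ℝ) :
    IsMarkovKernel (boltzmann πref τ q) := by
  unfold boltzmann; infer_instance

/-- The set of actions at which `q (x, ·)` equals its essential supremum under `πref x`. -/
def optActions (πref : Kernel S A) (q : S × A → ℝ) (x : S) : Set A :=
  {a | q (x, a) = essSup (fun a' => q (x, a')) (πref x)}

/-- The reference policy filtered by `q`: `πref x` restricted to `optActions πref q x` and
normalized. -/
def filteredPolicy (πref : Kernel S A) [IsMarkovKernel πref] (q : S × A → ℝ) : Kernel S A :=
  toPolicy πref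
    (πref.withDensity fun x a =>
      (πref x (optActions πref q x))⁻¹ * (optActions πref q x).indicator (fun _ => 1) a)

instance (πref : Kernel S A) [IsMarkovKernel πref] (q : S × A → ℝ) :
    IsMarkovKernel (filteredPolicy πref q) := by
  unfold filteredPolicy; infer_instance

/-- The coverage assumption on the reference policy. -/
def Coverage (M : MDP S A) (πref : Kernel S A) : Prop :=
  ∃ pmin : ℝ≥0∞, 0 < pmin ∧
    ∀ τ : ℝ, 0 < τ → ∀ x : S, pmin ≤ πref x (optActions πref (M.qSoft πref τ) x)

/-- The temperature-decoupled policy `π^{τ,σ}`: the Boltzmann–Gibbs policy at temperature `τ`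
whose potential is `q^⋆_σ`. -/
def decoupledPolicy (M : MDP S A) (πref : Kernel S A) [IsMarkovKernel πref] (τ σ : ℝ) :
    Kernel S A :=
  boltzmann πref τ (M.qSoft πref σ)

instance (M : MDP S A) (πref : Kernel S A) [IsMarkovKernel πref] (τ σ : ℝ) :
    IsMarkovKernel (M.decoupledPolicy πref τ σ) := by
  unfold decoupledPolicy; infer_instance

end MDP

/-- The `p`-Wasserstein distance of measures on `ℝ`, as an infimum over couplings. -/
def wasserstein (p : ℝ) (μ ν : Measure ℝ) : ℝ≥0∞ :=
  (⨅ κ ∈ {κ : Measure (ℝ × ℝ) | κ.map Prod.fst = μ ∧ κ.map Prod.snd = ν},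
    ∫⁻ z, edist z.1 z.2 ^ p ∂κ) ^ (1 / p)

/-- The integrated Wasserstein metric `w̄_{p,p';ω}(ζ, ζ') = (∫ w_p(ζ_y, ζ'_y)^{p'} dω(y))^{1/p'}`. -/
def integratedWasserstein {Y : Type*} [MeasurableSpace Y] (p p' : ℝ) (ω : Measure Y)
    (ζ ζ' : Kernel Y ℝ) : ℝ≥0∞ :=
  (∫⁻ y, wasserstein p (ζ y) (ζ' y) ^ p' ∂ω) ^ (1 / p')

end

/-! ### Convergence in total variation -/

/-! The proof has two halves: the decoupled policies converge in total variation at each state, and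
such convergence of policies forces Wasserstein convergence of returns.

Policies. With `δ` the coverage constant and `e` the essential supremum of `q`, keeping only the
maximizers in the log-sum-exp gives `e + τ log δ ≤ V_τ q ≤ e`. Contraction turns this into `|q_σ -
q_ref| ≤ K σ`, uniformly (`exists_abs_qSoft_sub_qRef_le`). Dividing by `τ`, the error in the
Boltzmann exponent is at most `K σ / τ`, which vanishes. So the weights `exp ((q_σ - e) / τ)`, with
`e` now the essential supremum of `q_ref`, tend to the indicator of the reference-optimal actions.
That set keeps positive mass in the limit (`measure_optActions_qRef_ne_zero`), hence the normalized
densities converge boundedly (`tvTendsto_decoupledPolicy`).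

Returns. Total variation convergence passes through composition with kernels (`TVTendsto.compProd`),
hence to histories of any fixed length. The return is a uniform limit of functions of finite
histories. Cutting its bounded range into finitely many cells and coupling the cell indices
optimally yields convergence of the transport cost (`tendsto_wasserstein_map`). Working with cells
avoids any regularity of the trajectory space, whose diagonal need not be measurable. Dominated
convergence then handles the integral over `ω`. -/

/-- Convergence of measures in total variation along a filter, tested on families of measurable
functions with values in `[-1, 1]`. -/
def TVTendsto {ι X : Type*} [MeasurableSpace X] (l : Filter ι) (μs : ι → Measure X)
    (μ : Measure X) : Prop :=
  ∀ f : ι → X → ℝ, (∀ i, Measurable (f i)) → (∀ i x, |f i x| ≤ 1) →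
    Tendsto (fun i => ∫ x, f i x ∂μs i - ∫ x, f i x ∂μ) l (𝓝 0)

theorem integrable_of_measurable_of_abs_le {X : Type*} [MeasurableSpace X] {μ : Measure X}
    [IsFiniteMeasure μ] {f : X → ℝ} (hf : Measurable f) {C : ℝ} (hC : ∀ x, |f x| ≤ C) :
    Integrable f μ :=
  Integrable.of_bound hf.aestronglyMeasurable C (ae_of_all _ hC)

theorem abs_integral_le_of_abs_le {X : Type*} [MeasurableSpace X] {μ : Measure X}
    [IsProbabilityMeasure μ] {f : X → ℝ} {C : ℝ} (hC : ∀ x, |f x| ≤ C) :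
    |∫ x, f x ∂μ| ≤ C := by
  simpa using norm_integral_le_of_norm_le_const (μ := μ) (f := f) (ae_of_all _ hC)

namespace TVTendsto

variable {ι X Y : Type*} [MeasurableSpace X] [MeasurableSpace Y] {l : Filter ι}

theorem const (μ : Measure X) : TVTendsto l (fun _ => μ) μ := by
  intro f _ _
  simpa using tendsto_const_nhds

theorem map {μs : ι → Measure X} {μ : Measure X} (h : TVTendsto l μs μ) {g : X → Y}
    (hg : Measurable g) : TVTendsto l (fun i => (μs i).map g) (μ.map g) := by
  intro f hf hf1
  simp_rw [fun (i : ι) (ν : Measure X) =>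
    integral_map (μ := ν) hg.aemeasurable (hf i).aestronglyMeasurable]
  exact h (fun i x => f i (g x)) (fun i => (hf i).comp hg) fun i x => hf1 i _

/-- Change the base measure first, then the kernel. The inner integral against `κs i` is itself a
test function depending on `i`, which is why `TVTendsto` tests on families. The second change needs
only pointwise convergence of the kernels, by dominated convergence under the fixed `μ`. -/
theorem compProd [l.IsCountablyGenerated] {μs : ι → Measure X} {μ : Measure X}
    [∀ i, IsProbabilityMeasure (μs i)] [IsProbabilityMeasure μ]
    {κs : ι → Kernel X Y} {κ : Kernel X Y} [∀ i, IsMarkovKernel (κs i)] [IsMarkovKernel κ]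
    (hμ : TVTendsto l μs μ) (hκ : ∀ x, TVTendsto l (fun i => κs i x) (κ x)) :
    TVTendsto l (fun i => μs i ⊗ₘ κs i) (μ ⊗ₘ κ) := by
  intro f hf hf1
  have hmeas (i : ι) (η : Kernel X Y) [IsMarkovKernel η] :
      Measurable fun x => ∫ y, f i (x, y) ∂η x :=
    ((hf i).stronglyMeasurable.integral_kernel_prod_right').measurable
  have hbd (i : ι) (η : Kernel X Y) [IsMarkovKernel η] (x : X) :
      |∫ y, f i (x, y) ∂η x| ≤ 1 := abs_integral_le_of_abs_le fun y => hf1 i _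
  have h1 := hμ (fun i x => ∫ y, f i (x, y) ∂κs i x) (fun i => hmeas i _) fun i x => hbd i _ x
  have h2 : Tendsto (fun i => ∫ x, (∫ y, f i (x, y) ∂κs i x - ∫ y, f i (x, y) ∂κ x) ∂μ) l
      (𝓝 (∫ _, (0 : ℝ) ∂μ)) := by
    refine tendsto_integral_filter_of_dominated_convergence (fun _ => 2)
      (Eventually.of_forall fun i => ((hmeas i _).sub (hmeas i _)).aestronglyMeasurable)
      (Eventually.of_forall fun i => ae_of_all _ fun x => ?_) (integrable_const _)
      (ae_of_all _ fun x => ?_)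
    · rw [Real.norm_eq_abs]
      calc _ ≤ |∫ y, f i (x, y) ∂κs i x| + |∫ y, f i (x, y) ∂κ x| := abs_sub _ _
        _ ≤ 2 := by linarith [hbd i (κs i) x, hbd i κ x]
    · exact hκ x (fun i y => f i (x, y)) (fun i => (hf i).comp measurable_prodMk_left)
        fun i y => hf1 i _
  have h3 := h1.add h2
  simp only [integral_zero, add_zero] at h3
  refine h3.congr fun i => ?_
  rw [Measure.integral_compProd (integrable_of_measurable_of_abs_le (hf i) (hf1 i)),
    Measure.integral_compProd (integrable_of_measurable_of_abs_le (hf i) (hf1 i)),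
    integral_sub (integrable_of_measurable_of_abs_le (hmeas i _) (hbd i _))
      (integrable_of_measurable_of_abs_le (hmeas i _) (hbd i _))]
  ring

theorem tendsto_measureReal {μs : ι → Measure X} {μ : Measure X} (h : TVTendsto l μs μ)
    {s : Set X} (hs : MeasurableSet s) :
    Tendsto (fun i => (μs i).real s) l (𝓝 (μ.real s)) := by
  have := h (fun _ => s.indicator fun _ => 1) (fun _ => measurable_const.indicator hs)
    fun _ x => by by_cases hx : x ∈ s <;> simp [hx]
  simp only [integral_indicator_const _ hs, smul_eq_mul, mul_one] at this
  simpa using this.add_const (μ.real s)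

theorem congr' {μs νs : ι → Measure X} {μ : Measure X} (h : TVTendsto l μs μ)
    (hν : ∀ᶠ i in l, μs i = νs i) : TVTendsto l νs μ := fun f hf hf1 =>
  (h f hf hf1).congr' (hν.mono fun i hi => by rw [hi])

/-- Densities that converge almost everywhere and boundedly give convergence in total
variation. -/
theorem withDensity [l.IsCountablyGenerated] {μ : Measure X} [IsFiniteMeasure μ]
    {ds : ι → X → ℝ} {d : X → ℝ} (hds : ∀ᶠ i in l, Measurable (ds i)) (hd : Measurable d)
    (hds0 : ∀ᶠ i in l, ∀ x, 0 ≤ ds i x) (hd0 : ∀ x, 0 ≤ d x) {K : ℝ}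
    (hK : ∀ᶠ i in l, ∀ᵐ x ∂μ, ds i x ≤ K) (hdK : ∀ᵐ x ∂μ, d x ≤ K)
    (hlim : ∀ᵐ x ∂μ, Tendsto (fun i => ds i x) l (𝓝 (d x))) :
    TVTendsto l (fun i => μ.withDensity fun x => ENNReal.ofReal (ds i x))
      (μ.withDensity fun x => ENNReal.ofReal (d x)) := by
  intro f hf hf1
  have key (g : X → ℝ) (hg : Measurable g) (hg0 : ∀ x, 0 ≤ g x) (i : ι) :
      ∫ x, f i x ∂(μ.withDensity fun x => ENNReal.ofReal (g x)) = ∫ x, g x * f i x ∂μ := by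
    rw [integral_withDensity_eq_integral_toReal_smul (by fun_prop) (by simp)]
    simp [ENNReal.toReal_ofReal (hg0 _)]
  have hint (g : X → ℝ) (hg : Measurable g) (hg0 : ∀ x, 0 ≤ g x) (hgK : ∀ᵐ x ∂μ, g x ≤ K) (i : ι) :
      Integrable (fun x => g x * f i x) μ := by
    refine Integrable.of_bound (hg.mul (hf i)).aestronglyMeasurable K ?_
    filter_upwards [hgK] with x hx
    rw [Real.norm_eq_abs, abs_mul, abs_of_nonneg (hg0 x)]
    calc _ ≤ g x * 1 := mul_le_mul_of_nonneg_left (hf1 i x) (hg0 x)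
      _ ≤ K := by simpa using hx
  have hle (i : ι) (x : X) : |(ds i x - d x) * f i x| ≤ |ds i x - d x| := by
    rw [abs_mul]
    exact mul_le_of_le_one_right (abs_nonneg _) (hf1 i x)
  have h2 : Tendsto (fun i => ∫ x, (ds i x - d x) * f i x ∂μ) l (𝓝 (∫ _, (0 : ℝ) ∂μ)) := by
    refine tendsto_integral_filter_of_dominated_convergence (fun _ => 2 * K) ?_ ?_
      (integrable_const _) ?_
    · filter_upwards [hds] with i hi
      exact ((hi.sub hd).mul (hf i)).aestronglyMeasurable
    · filter_upwards [hds0, hK] with i h0 hi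
      filter_upwards [hi, hdK] with x hx hx'
      refine (hle i x).trans ((abs_sub _ _).trans ?_)
      rw [abs_of_nonneg (h0 x), abs_of_nonneg (hd0 x)]
      linarith
    · filter_upwards [hlim] with x hx
      have h0 : Tendsto (fun i => |ds i x - d x|) l (𝓝 0) := by
        simpa using (hx.sub_const (d x)).abs
      exact squeeze_zero_norm (fun i => hle i x) h0
  simp only [integral_zero] at h2
  refine h2.congr' ?_
  filter_upwards [hds, hds0, hK] with i h1 h2 h3
  rw [key _ h1 h2, key _ hd hd0, ← integral_sub (hint _ h1 h2 h3 i) (hint _ hd hd0 hdK i)]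
  simp_rw [sub_mul]

end TVTendsto

/-! ### Couplings and Wasserstein distances -/

theorem integral_comp_eq_sum {Ω : Type*} [MeasurableSpace Ω] {N : ℕ} (μ : Measure Ω)
    [IsProbabilityMeasure μ] {I : Ω → Fin N} (hI : Measurable I) (g : Fin N → ℝ) :
    ∫ x, g (I x) ∂μ = ∑ i, μ.real (I ⁻¹' {i}) * g i := by
  have := Measure.isProbabilityMeasure_map (μ := μ) hI.aemeasurable
  rw [← integral_map (f := g) hI.aemeasurable (measurable_of_finite g).aestronglyMeasurable,
    integral_fintype (Integrable.of_finite)]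
  simp [map_measureReal_apply hI (measurableSet_singleton _)]

theorem sum_measureReal_preimage {Ω : Type*} [MeasurableSpace Ω] {N : ℕ} (μ : Measure Ω)
    [IsProbabilityMeasure μ] {I : Ω → Fin N} (hI : Measurable I) :
    ∑ i, μ.real (I ⁻¹' {i}) = 1 := by
  simpa using (integral_comp_eq_sum μ hI fun _ => 1).symm

/-- There are finitely many null cells. The coupling density below divides by cell masses, so its
marginal identities are available only off these cells. -/
theorem ae_measureReal_preimage_ne_zero {Ω : Type*} [MeasurableSpace Ω] {N : ℕ} (μ : Measure Ω)
    [IsProbabilityMeasure μ] (I : Ω → Fin N) :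
    ∀ᵐ x ∂μ, μ.real (I ⁻¹' {I x}) ≠ 0 := by
  have h (i : Fin N) : ∀ᵐ x ∂μ, I x = i → μ.real (I ⁻¹' {i}) ≠ 0 := by
    by_cases hi : μ.real (I ⁻¹' {i}) = 0
    · have : ∀ᵐ x ∂μ, x ∉ I ⁻¹' {i} := measure_eq_zero_iff_ae_notMem.1 (by
        simpa [measureReal_eq_zero_iff] using hi)
      filter_upwards [this] with x hx hxi
      exact (hx hxi).elim
    · exact ae_of_all _ fun _ _ => hi
  filter_upwards [ae_all_iff.2 h] with x hx
  exact hx _ rfl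

theorem map_fst_withDensity_prod {Ω Ω' : Type*} [MeasurableSpace Ω] [MeasurableSpace Ω']
    (μ : Measure Ω) (ν : Measure Ω') [IsProbabilityMeasure μ] [IsProbabilityMeasure ν]
    {D : Ω × Ω' → ℝ≥0∞} (hD : Measurable D) (h : ∀ᵐ x ∂μ, ∫⁻ y, D (x, y) ∂ν = 1) :
    ((μ.prod ν).withDensity D).map Prod.fst = μ := by
  ext s hs
  rw [Measure.map_apply measurable_fst hs, withDensity_apply _ (measurable_fst hs),
    ← lintegral_indicator (measurable_fst hs),
    lintegral_prod _ ((hD.indicator (measurable_fst hs)).aemeasurable),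
    ← lintegral_indicator_one hs]
  refine lintegral_congr_ae ?_
  filter_upwards [h] with x hx
  by_cases hxs : x ∈ s
  · simpa [Set.indicator, hxs] using hx
  · simp [Set.indicator, hxs]

theorem map_snd_withDensity_prod {Ω Ω' : Type*} [MeasurableSpace Ω] [MeasurableSpace Ω']
    (μ : Measure Ω) (ν : Measure Ω') [IsProbabilityMeasure μ] [IsProbabilityMeasure ν]
    {D : Ω × Ω' → ℝ≥0∞} (hD : Measurable D) (h : ∀ᵐ y ∂ν, ∫⁻ x, D (x, y) ∂μ = 1) :
    ((μ.prod ν).withDensity D).map Prod.snd = ν := by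
  ext s hs
  rw [Measure.map_apply measurable_snd hs, withDensity_apply _ (measurable_snd hs),
    ← lintegral_indicator (measurable_snd hs),
    lintegral_prod_symm _ ((hD.indicator (measurable_snd hs)).aemeasurable),
    ← lintegral_indicator_one hs]
  refine lintegral_congr_ae ?_
  filter_upwards [h] with y hy
  by_cases hys : y ∈ s
  · simpa [Set.indicator, hys] using hy
  · simp [Set.indicator, hys]

/-- Two probability measures have a coupling under which a finite-valued statistic `I` differs with
probability at most the total variation distance of its two laws. -/
theorem exists_coupling_finite_statistic {Ω : Type*} [MeasurableSpace Ω] {N : ℕ}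
    (μ ν : Measure Ω) [IsProbabilityMeasure μ] [IsProbabilityMeasure ν] {I : Ω → Fin N}
    (hI : Measurable I) :
    ∃ κ : Measure (Ω × Ω), κ.map Prod.fst = μ ∧ κ.map Prod.snd = ν ∧
      κ {z | I z.1 ≠ I z.2} ≤
        ENNReal.ofReal (1 - ∑ i, min (μ.real (I ⁻¹' {i})) (ν.real (I ⁻¹' {i}))) := by
  set a : Fin N → ℝ := fun i => μ.real (I ⁻¹' {i}) with ha
  set b : Fin N → ℝ := fun i => ν.real (I ⁻¹' {i}) with hb
  set m : Fin N → ℝ := fun i => min (a i) (b i) with hm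
  have ha0 (i) : 0 ≤ a i := measureReal_nonneg
  have hb0 (i) : 0 ≤ b i := measureReal_nonneg
  have hm0 (i) : 0 ≤ m i := le_min (ha0 i) (hb0 i)
  have hma (i) : 0 ≤ a i - m i := sub_nonneg.2 (min_le_left _ _)
  have hmb (i) : 0 ≤ b i - m i := sub_nonneg.2 (min_le_right _ _)
  set c : ℝ := 1 - ∑ i, m i with hc
  have hca : ∑ i, (a i - m i) = c := by
    rw [Finset.sum_sub_distrib, sum_measureReal_preimage μ hI]
  have hcb : ∑ i, (b i - m i) = c := by
    rw [Finset.sum_sub_distrib, sum_measureReal_preimage ν hI]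
  have hc0 : 0 ≤ c := hca ▸ Finset.sum_nonneg fun i _ => hma i
  -- The density is constant on products of cells. Cell `(i, i)` receives the shared mass `m i`; the
  -- excesses `a - m` and `b - m`, both of total `c`, are coupled independently, which accounts for
  -- the factor `1 / c`. Dividing by `a i * b j` turns masses into densities for `μ.prod ν`. If `c =
  -- 0` the excesses vanish, so division by zero is harmless.
  set e : Fin N → Fin N → ℝ := fun i j => (a i - m i) * (b j - m j) / c / (a i * b j) with he
  set h : Fin N → Fin N → ℝ := fun i j => (if i = j then m i else 0) / (a i * b j) + e i j with hh
  have he0 (i j) : 0 ≤ e i j := by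
    have := hma i; have := hmb j; have := ha0 i; have := hb0 j
    positivity
  have hh0 (i j) : 0 ≤ h i j := by
    have := hm0 i; have := ha0 i; have := hb0 j
    refine add_nonneg ?_ (he0 i j)
    split_ifs <;> positivity
  have hmeas (g : Fin N → Fin N → ℝ) : Measurable fun z : Ω × Ω => g (I z.1) (I z.2) :=
    (measurable_of_finite (Function.uncurry g)).comp
      ((hI.comp measurable_fst).prodMk (hI.comp measurable_snd))
  have hlint (ρ : Measure Ω) [IsProbabilityMeasure ρ] (g : Fin N → ℝ) (hg : ∀ i, 0 ≤ g i) :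
      ∫⁻ y, ENNReal.ofReal (g (I y)) ∂ρ = ENNReal.ofReal (∑ i, ρ.real (I ⁻¹' {i}) * g i) := by
    rw [← integral_comp_eq_sum ρ hI g, ofReal_integral_eq_lintegral_ofReal _
      (ae_of_all _ fun x => hg _)]
    exact integrable_of_measurable_of_abs_le ((measurable_of_finite g).comp hI)
      (C := ∑ i, |g i|) fun x => Finset.single_le_sum (f := fun i => |g i|)
        (fun i _ => abs_nonneg _) (Finset.mem_univ _)
  have hbj (j : Fin N) (hj : b j = 0) : m j = 0 := le_antisymm (hj ▸ min_le_right _ _) (hm0 j)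
  have hai (i : Fin N) (hi : a i = 0) : m i = 0 := le_antisymm (hi ▸ min_le_left _ _) (hm0 i)
  have hac (i : Fin N) (h0 : c = 0) : a i - m i = 0 :=
    (Finset.sum_eq_zero_iff_of_nonneg fun i _ => hma i).1 (hca.trans h0) i (Finset.mem_univ _)
  have hbc (i : Fin N) (h0 : c = 0) : b i - m i = 0 :=
    (Finset.sum_eq_zero_iff_of_nonneg fun i _ => hmb i).1 (hcb.trans h0) i (Finset.mem_univ _)
  have hrow (i : Fin N) (hi : a i ≠ 0) : ∑ j, b j * h i j = 1 := by
    have hterm (j : Fin N) :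
        b j * h i j = (if i = j then m i else 0) / a i + (a i - m i) / c / a i * (b j - m j) := by
      by_cases hj : b j = 0
      · have := hbj j hj
        by_cases hij : i = j
        · subst hij; simp [hj, this]
        · simp [hj, this, hij]
      · by_cases hc1 : c = 0
        · simp only [hh, he, hac i hc1, zero_mul, zero_div, add_zero]
          field_simp
        · simp only [hh, he]
          field_simp
    rw [Finset.sum_congr rfl fun j _ => hterm j, Finset.sum_add_distrib, ← Finset.mul_sum, hcb,
      ← Finset.sum_div, Finset.sum_ite_eq]
    by_cases hc1 : c = 0
    · have := hac i hc1
      have h2 : m i = a i := by linarith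
      simp [hc1, h2, hi]
    · simp only [Finset.mem_univ, if_true]
      field_simp
      ring
  have hcol (j : Fin N) (hj : b j ≠ 0) : ∑ i, a i * h i j = 1 := by
    have hterm (i : Fin N) :
        a i * h i j = (if i = j then m i else 0) / b j + (b j - m j) / c / b j * (a i - m i) := by
      by_cases hi : a i = 0
      · have := hai i hi
        by_cases hij : i = j
        · subst hij; simp [hi, this]
        · simp [hi, this, hij]
      · by_cases hc1 : c = 0
        · simp only [hh, he, hac i hc1, zero_mul, zero_div, add_zero, mul_zero]
          field_simp
        · simp only [hh, he]
          field_simp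
    rw [Finset.sum_congr rfl fun i _ => hterm i, Finset.sum_add_distrib, ← Finset.mul_sum, hca,
      ← Finset.sum_div, Finset.sum_ite_eq']
    by_cases hc1 : c = 0
    · have := hbc j hc1
      have h2 : m j = b j := by linarith
      simp [hc1, h2, hj]
    · simp only [Finset.mem_univ, if_true]
      field_simp
      ring
  have hDm : Measurable fun z : Ω × Ω => ENNReal.ofReal (h (I z.1) (I z.2)) :=
    (hmeas h).ennreal_ofReal
  refine ⟨(μ.prod ν).withDensity fun z => ENNReal.ofReal (h (I z.1) (I z.2)),
    map_fst_withDensity_prod μ ν hDm ?_, map_snd_withDensity_prod μ ν hDm ?_, ?_⟩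
  · filter_upwards [ae_measureReal_preimage_ne_zero μ I] with x hx
    rw [hlint ν (h (I x)) (hh0 _), hrow _ hx, ENNReal.ofReal_one]
  · filter_upwards [ae_measureReal_preimage_ne_zero ν I] with y hy
    rw [hlint μ (fun i => h i (I y)) (fun i => hh0 i _), hcol _ hy, ENNReal.ofReal_one]
  · have hset : MeasurableSet {z : Ω × Ω | I z.1 ≠ I z.2} :=
      (measurableSet_eq_fun (hI.comp measurable_fst) (hI.comp measurable_snd)).compl
    rw [withDensity_apply _ hset]
    calc ∫⁻ z in {z : Ω × Ω | I z.1 ≠ I z.2}, ENNReal.ofReal (h (I z.1) (I z.2)) ∂(μ.prod ν)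
        = ∫⁻ z in {z : Ω × Ω | I z.1 ≠ I z.2}, ENNReal.ofReal (e (I z.1) (I z.2)) ∂(μ.prod ν) :=
          setLIntegral_congr_fun hset fun z hz => by
            have : I z.1 ≠ I z.2 := hz
            simp [hh, this]
      _ ≤ ∫⁻ z, ENNReal.ofReal (e (I z.1) (I z.2)) ∂(μ.prod ν) := setLIntegral_le_lintegral _ _
      _ = ENNReal.ofReal (∑ i, a i * ∑ j, b j * e i j) := by
          rw [lintegral_prod _ (hmeas e).ennreal_ofReal.aemeasurable]
          simp only [hlint ν (e _) (he0 _)]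
          exact hlint μ (fun i => ∑ j, b j * e i j) fun i =>
            Finset.sum_nonneg fun j _ => mul_nonneg (hb0 j) (he0 i j)
      _ ≤ ENNReal.ofReal c := by
          refine ENNReal.ofReal_le_ofReal ?_
          -- Only an inequality, because the density is zero by convention on null cells.
          have hterm (i j : Fin N) : a i * (b j * e i j) ≤ (a i - m i) * (b j - m j) / c := by
            have h0 : 0 ≤ (a i - m i) * (b j - m j) / c :=
              div_nonneg (mul_nonneg (hma i) (hmb j)) hc0
            by_cases hi : a i = 0
            · simpa [hi] using h0
            by_cases hj : b j = 0
            · simpa [hj] using h0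
            simp only [he]
            exact le_of_eq (by field_simp)
          calc ∑ i, a i * ∑ j, b j * e i j ≤ ∑ i, ∑ j, (a i - m i) * (b j - m j) / c := by
                simp_rw [Finset.mul_sum]
                exact Finset.sum_le_sum fun i _ => Finset.sum_le_sum fun j _ => hterm i j
            _ = c * c / c := by
                simp_rw [← Finset.sum_div, ← Finset.mul_sum, ← Finset.sum_mul]
                rw [hca, hcb]
            _ ≤ c := by
                by_cases hc1 : c = 0
                · simp [hc1]
                · rw [mul_div_assoc, div_self hc1, mul_one]

/-- The transport cost `inf_κ ∫ |x - y|^p dκ` whose `p`-th root is the Wasserstein distance. -/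
noncomputable def transportCost (p : ℝ) (μ ν : Measure ℝ) : ℝ≥0∞ :=
  ⨅ κ ∈ {κ : Measure (ℝ × ℝ) | κ.map Prod.fst = μ ∧ κ.map Prod.snd = ν},
    ∫⁻ z, edist z.1 z.2 ^ p ∂κ

theorem transportCost_le {p : ℝ} {μ ν : Measure ℝ} {κ : Measure (ℝ × ℝ)}
    (hμ : κ.map Prod.fst = μ) (hν : κ.map Prod.snd = ν) :
    transportCost p μ ν ≤ ∫⁻ z, edist z.1 z.2 ^ p ∂κ :=
  iInf₂_le κ ⟨hμ, hν⟩

/-- A coupling bound for the images of two measures under a function `G` with oscillation at most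
`ε` on the level sets of a finite-valued statistic. -/
theorem transportCost_map_le {Ω : Type*} [MeasurableSpace Ω] {N : ℕ} (μ ν : Measure Ω)
    [IsProbabilityMeasure μ] [IsProbabilityMeasure ν] {I : Ω → Fin N} (hI : Measurable I)
    {G : Ω → ℝ} (hG : Measurable G) {R : ℝ} (hR : ∀ x, |G x| ≤ R) {ε : ℝ}
    (hε : ∀ x y, I x = I y → |G x - G y| ≤ ε) {p : ℝ} (hp : 0 ≤ p) :
    transportCost p (μ.map G) (ν.map G) ≤ ENNReal.ofReal ε ^ p +
      ENNReal.ofReal (2 * R) ^ p *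
        ENNReal.ofReal (1 - ∑ i, min (μ.real (I ⁻¹' {i})) (ν.real (I ⁻¹' {i}))) := by
  obtain ⟨κ, h1, h2, h3⟩ := exists_coupling_finite_statistic μ ν hI
  have hκ : κ Set.univ = 1 := by
    have : κ.map Prod.fst Set.univ = 1 := by rw [h1]; exact measure_univ
    rwa [Measure.map_apply measurable_fst MeasurableSet.univ, Set.preimage_univ] at this
  have hGG : Measurable (Prod.map G G) := hG.prodMap hG
  have hset : MeasurableSet {z : Ω × Ω | I z.1 ≠ I z.2} :=
    (measurableSet_eq_fun (hI.comp measurable_fst) (hI.comp measurable_snd)).compl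
  refine (transportCost_le (κ := κ.map (Prod.map G G)) ?_ ?_).trans ?_
  · rw [Measure.map_map measurable_fst hGG, ← h1, Measure.map_map hG measurable_fst]
    rfl
  · rw [Measure.map_map measurable_snd hGG, ← h2, Measure.map_map hG measurable_snd]
    rfl
  · rw [lintegral_map (by fun_prop) hGG]
    calc ∫⁻ z, edist (Prod.map G G z).1 (Prod.map G G z).2 ^ p ∂κ
        ≤ ∫⁻ z, (ENNReal.ofReal ε ^ p + {z : Ω × Ω | I z.1 ≠ I z.2}.indicator
            (fun _ => ENNReal.ofReal (2 * R) ^ p) z) ∂κ := by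
          refine lintegral_mono fun z => ?_
          simp only [Prod.map_fst, Prod.map_snd, edist_dist, Real.dist_eq]
          by_cases hz : I z.1 = I z.2
          · exact le_add_right (ENNReal.rpow_le_rpow (ENNReal.ofReal_le_ofReal (hε _ _ hz)) hp)
          · have : |G z.1 - G z.2| ≤ 2 * R := by
              linarith [abs_sub (G z.1) (G z.2), hR z.1, hR z.2]
            simp only [Set.indicator, Set.mem_ofPred_eq, ne_eq, hz, not_false_eq_true, if_true]
            exact le_add_left (ENNReal.rpow_le_rpow (ENNReal.ofReal_le_ofReal this) hp)
      _ ≤ _ := by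
          rw [lintegral_add_left measurable_const, lintegral_const, hκ, mul_one,
            lintegral_indicator_const hset]
          gcongr

theorem wasserstein_eq_transportCost (p : ℝ) (μ ν : Measure ℝ) :
    wasserstein p μ ν = transportCost p μ ν ^ (1 / p) := rfl

theorem wasserstein_map_le {Ω : Type*} [MeasurableSpace Ω] (μ ν : Measure Ω)
    [IsProbabilityMeasure μ] [IsProbabilityMeasure ν] {G : Ω → ℝ} (hG : Measurable G) {R : ℝ}
    (hR : ∀ x, |G x| ≤ R) {p : ℝ} (hp : 0 < p) :
    wasserstein p (μ.map G) (ν.map G) ≤ ENNReal.ofReal (2 * R) := by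
  -- With a single cell the indices never disagree, and the oscillation is the full range `2 * R`.
  have h := transportCost_map_le μ ν (I := fun _ => (0 : Fin 1)) measurable_const hG hR
    (ε := 2 * R) (fun x y _ => by linarith [abs_sub (G x) (G y), hR x, hR y]) hp.le
  simp only [Finset.univ_unique, Finset.sum_singleton, Fin.default_eq_zero,
    Set.preimage_const_of_mem (Set.mem_singleton _), probReal_univ, min_self, sub_self,
    ENNReal.ofReal_zero, mul_zero, add_zero] at h
  rw [wasserstein_eq_transportCost]
  calc _ ≤ (ENNReal.ofReal (2 * R) ^ p) ^ (1 / p) := ENNReal.rpow_le_rpow h (by positivity)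
    _ = _ := by rw [← ENNReal.rpow_mul, mul_one_div_cancel hp.ne', ENNReal.rpow_one]

/-- The index of the cell of width `ε` of a partition of `[-R, R]`. -/
noncomputable def cellIndex (R ε : ℝ) (x : ℝ) : Fin (⌊2 * R / ε⌋₊ + 1) :=
  Fin.ofNat _ ⌊(x + R) / ε⌋₊

theorem measurable_cellIndex (R ε : ℝ) : Measurable (cellIndex R ε) :=
  (measurable_from_nat (f := Fin.ofNat (⌊2 * R / ε⌋₊ + 1))).comp
    (Nat.measurable_floor.comp (by fun_prop))

theorem abs_sub_le_of_cellIndex_eq {R ε x y : ℝ} (hε : 0 < ε) (hx : |x| ≤ R) (hy : |y| ≤ R)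
    (h : cellIndex R ε x = cellIndex R ε y) : |x - y| ≤ ε := by
  -- `Fin.ofNat` reduces modulo the number of cells. On `[-R, R]` the floor is at most its value at
  -- `z = R`, which the extra cell accommodates, so nothing wraps around.
  have hlt {z : ℝ} (hz : |z| ≤ R) : ⌊(z + R) / ε⌋₊ < ⌊2 * R / ε⌋₊ + 1 := by
    refine Nat.lt_succ_of_le (Nat.floor_le_floor ?_)
    gcongr
    linarith [(abs_le.1 hz).2]
  have h' : ⌊(x + R) / ε⌋₊ = ⌊(y + R) / ε⌋₊ := by
    have := congrArg Fin.val h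
    simpa [cellIndex, Fin.ofNat, Nat.mod_eq_of_lt (hlt hx), Nat.mod_eq_of_lt (hlt hy)] using this
  have hx0 : 0 ≤ (x + R) / ε := div_nonneg (by linarith [(abs_le.1 hx).1]) hε.le
  have hy0 : 0 ≤ (y + R) / ε := div_nonneg (by linarith [(abs_le.1 hy).1]) hε.le
  have h1 := Nat.floor_le hx0
  have h2 := Nat.lt_floor_add_one ((x + R) / ε)
  have h3 := Nat.floor_le hy0
  have h4 := Nat.lt_floor_add_one ((y + R) / ε)
  rw [h'] at h1 h2
  have h5 : |(x + R) / ε - (y + R) / ε| ≤ 1 := abs_le.2 ⟨by linarith, by linarith⟩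
  rw [← sub_div, abs_div, abs_of_pos hε, div_le_one hε] at h5
  simpa using h5

/-- If `G` is a uniform limit of statistics whose laws converge setwise, the laws of `G` converge
in Wasserstein distance. -/
theorem tendsto_wasserstein_map {ι Ω : Type*} [MeasurableSpace Ω] {l : Filter ι}
    (μs : ι → Measure Ω) (μ : Measure Ω) [∀ i, IsProbabilityMeasure (μs i)]
    [IsProbabilityMeasure μ] {G : Ω → ℝ} (hG : Measurable G) {R : ℝ} (hR : ∀ x, |G x| ≤ R)
    (happrox : ∀ ε > 0, ∃ H : Ω → ℝ, Measurable H ∧ (∀ x, |H x| ≤ R) ∧ (∀ x, |G x - H x| ≤ ε) ∧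
      ∀ s, MeasurableSet s →
        Tendsto (fun i => (μs i).real (H ⁻¹' s)) l (𝓝 (μ.real (H ⁻¹' s))))
    {p : ℝ} (hp : 0 < p) :
    Tendsto (fun i => wasserstein p ((μs i).map G) (μ.map G)) l (𝓝 0) := by
  suffices h : Tendsto (fun i => transportCost p ((μs i).map G) (μ.map G)) l (𝓝 0) by
    have h2 := h.ennrpow_const (1 / p)
    rwa [ENNReal.zero_rpow_of_pos (by positivity)] at h2
  have hbound (ε : ℝ) (hε : 0 < ε) : limsup (fun i => transportCost p ((μs i).map G) (μ.map G)) l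
      ≤ ENNReal.ofReal (3 * ε) ^ p := by
    obtain ⟨H, hH, hHR, hGH, hconv⟩ := happrox ε hε
    have hI : Measurable fun x => cellIndex R ε (H x) := (measurable_cellIndex R ε).comp hH
    -- One `ε` is the cell width; the other two come from replacing `G` by `H` at `x` and at `y`.
    have hosc (x y : Ω) (h : cellIndex R ε (H x) = cellIndex R ε (H y)) :
        |G x - G y| ≤ 3 * ε := by
      have h1 := abs_le.1 (abs_sub_le_of_cellIndex_eq hε (hHR x) (hHR y) h)
      have h2 := abs_le.1 (hGH x)
      have h3 := abs_le.1 (hGH y)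
      exact abs_le.2 ⟨by linarith, by linarith⟩
    have hlim : Tendsto (fun i => ENNReal.ofReal (3 * ε) ^ p + ENNReal.ofReal (2 * R) ^ p *
        ENNReal.ofReal (1 - ∑ k, min ((μs i).real ((fun x => cellIndex R ε (H x)) ⁻¹' {k}))
          (μ.real ((fun x => cellIndex R ε (H x)) ⁻¹' {k})))) l
        (𝓝 (ENNReal.ofReal (3 * ε) ^ p)) := by
      have h1 : Tendsto (fun i => 1 - ∑ k,
          min ((μs i).real ((fun x => cellIndex R ε (H x)) ⁻¹' {k}))
            (μ.real ((fun x => cellIndex R ε (H x)) ⁻¹' {k}))) l (𝓝 0) := by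
        have : (0 : ℝ) = 1 - ∑ k, min (μ.real ((fun x => cellIndex R ε (H x)) ⁻¹' {k}))
            (μ.real ((fun x => cellIndex R ε (H x)) ⁻¹' {k})) := by
          simp [min_self, sum_measureReal_preimage μ hI]
        rw [this]
        exact tendsto_const_nhds.sub (tendsto_finsetSum _ fun k _ =>
          (hconv _ (measurable_cellIndex R ε (measurableSet_singleton k))).min tendsto_const_nhds)
      have h2 := (ENNReal.tendsto_ofReal h1)
      rw [ENNReal.ofReal_zero] at h2
      have h3 := ENNReal.Tendsto.const_mul (a := ENNReal.ofReal (2 * R) ^ p) h2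
        (Or.inr (ENNReal.rpow_ne_top_of_nonneg hp.le ENNReal.ofReal_ne_top))
      simpa using h3.const_add (ENNReal.ofReal (3 * ε) ^ p)
    rcases l.eq_or_neBot with rfl | hl
    · simp
    rw [← hlim.limsup_eq]
    exact limsup_le_limsup (Eventually.of_forall fun i =>
      transportCost_map_le (μs i) μ hI hG hR hosc hp.le)
  have hzero : limsup (fun i => transportCost p ((μs i).map G) (μ.map G)) l ≤ 0 := by
    have h1 : Tendsto (fun ε : ℝ => ENNReal.ofReal (3 * ε) ^ p) (𝓝[>] 0) (𝓝 0) := by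
      have h0 : Tendsto (fun ε : ℝ => 3 * ε) (𝓝[>] 0) (𝓝 0) := by
        have : Tendsto (fun ε : ℝ => 3 * ε) (𝓝 0) (𝓝 (3 * 0)) := tendsto_id.const_mul 3
        simpa using this.mono_left nhdsWithin_le_nhds
      have := (ENNReal.tendsto_ofReal h0).ennrpow_const p
      rwa [ENNReal.ofReal_zero, ENNReal.zero_rpow_of_pos hp] at this
    exact ge_of_tendsto h1 (eventually_mem_nhdsWithin.mono fun ε hε => hbound ε hε)
  exact tendsto_of_le_liminf_of_limsup_le zero_le hzero

/-- Pointwise convergence in Wasserstein distance with a uniform bound implies convergence of the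
integrated distance; no measurability of the distance in the parameter is needed. -/
theorem tendsto_integratedWasserstein {ι Y : Type*} [MeasurableSpace Y] {l : Filter ι}
    [l.IsCountablyGenerated] (ω : Measure Y) [IsProbabilityMeasure ω] (ζs : ι → Kernel Y ℝ)
    (ζ : Kernel Y ℝ) {p p' : ℝ} (hp' : 0 < p') {K : ℝ≥0∞} (hK : K ≠ ∞)
    (hbdd : ∀ i y, wasserstein p (ζs i y) (ζ y) ≤ K)
    (hlim : ∀ y, Tendsto (fun i => wasserstein p (ζs i y) (ζ y)) l (𝓝 0)) :
    Tendsto (fun i => integratedWasserstein p p' ω (ζs i) ζ) l (𝓝 0) := by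
  -- The lower integral of a possibly nonmeasurable function is attained by a measurable minorant;
  -- dominated convergence is applied to these minorants.
  choose g hg hgle hgint using fun i =>
    exists_measurable_le_lintegral_eq ω fun y => wasserstein p (ζs i y) (ζ y) ^ p'
  have h : Tendsto (fun i => ∫⁻ y, g i y ∂ω) l (𝓝 (∫⁻ _, 0 ∂ω)) := by
    refine tendsto_lintegral_filter_of_dominated_convergence (fun _ => K ^ p')
      (Eventually.of_forall hg)
      (Eventually.of_forall fun i => ae_of_all _ fun y =>
        (hgle i y).trans (ENNReal.rpow_le_rpow (hbdd i y) hp'.le)) ?_ (ae_of_all _ fun y => ?_)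
    · simpa using ENNReal.rpow_ne_top_of_nonneg hp'.le hK
    · have h1 := (hlim y).ennrpow_const p'
      rw [ENNReal.zero_rpow_of_pos hp'] at h1
      exact tendsto_of_tendsto_of_tendsto_of_le_of_le tendsto_const_nhds h1
        (fun _ => zero_le) fun i => hgle i y
  rw [lintegral_zero] at h
  have h2 := h.ennrpow_const (1 / p')
  rw [ENNReal.zero_rpow_of_pos (by positivity)] at h2
  simpa only [integratedWasserstein, hgint] using h2

/-! ### Return distributions depend continuously on the policy -/

namespace MDP

variable {S A : Type*} [MeasurableSpace S] [MeasurableSpace A]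

theorem stepKernel_apply (M : MDP S A) (π : Kernel S A) [IsMarkovKernel π] (z : S × A) :
    M.stepKernel π z = M.P z ⊗ₘ π := by
  ext s hs
  rw [stepKernel, Kernel.compProd_apply hs, Measure.compProd_apply hs]
  rfl

theorem tvTendsto_stepKernel {ι : Type*} {l : Filter ι} [l.IsCountablyGenerated] (M : MDP S A)
    (πs : ι → Kernel S A) (π : Kernel S A) [∀ i, IsMarkovKernel (πs i)] [IsMarkovKernel π]
    (h : ∀ x, TVTendsto l (fun i => πs i x) (π x)) (z : S × A) :
    TVTendsto l (fun i => M.stepKernel (πs i) z) (M.stepKernel π z) := by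
  simp_rw [stepKernel_apply]
  exact (TVTendsto.const _).compProd h

/-- Appends a state-action pair to a history. -/
def historySnoc (b : ℕ) (w : ((i : Finset.Iic b) → S × A) × (S × A)) :
    (i : Finset.Iic (b + 1)) → S × A :=
  fun i => if h : i.1 ≤ b then w.1 ⟨i.1, Finset.mem_Iic.2 h⟩ else w.2

theorem measurable_historySnoc (b : ℕ) : Measurable (historySnoc (S := S) (A := A) b) := by
  refine measurable_pi_lambda _ fun i => ?_
  unfold historySnoc
  by_cases h : i.1 ≤ b
  · simp only [h, dite_true]
    fun_prop
  · simp only [h, dite_false]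
    fun_prop

instance (M : MDP S A) (π : Kernel S A) [IsMarkovKernel π] : IsMarkovKernel (M.trajKernel π) := by
  unfold trajKernel; infer_instance

/-- Induction on the horizon: the longer history is the shorter one composed with one transition.
The horizon must stay fixed, since laws of infinite trajectories can be mutually singular even for
nearby policies. -/
theorem tvTendsto_trajKernel_frestrictLe {ι : Type*} {l : Filter ι} [l.IsCountablyGenerated]
    (M : MDP S A) (πs : ι → Kernel S A) (π : Kernel S A) [∀ i, IsMarkovKernel (πs i)]
    [IsMarkovKernel π] (h : ∀ x, TVTendsto l (fun i => πs i x) (π x)) (z : S × A) (b : ℕ) :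
    TVTendsto l (fun i => (M.trajKernel (πs i) z).map (Preorder.frestrictLe b))
      ((M.trajKernel π z).map (Preorder.frestrictLe b)) := by
  have hmap (η : Kernel S A) [IsMarkovKernel η] (b : ℕ) :
      (M.trajKernel η z).map (Preorder.frestrictLe b) =
        Kernel.partialTraj (X := fun _ => S × A) (M.historyKernel η) 0 b fun _ => z :=
    Kernel.traj_map_frestrictLe_apply 0 b _
  induction b with
  | zero =>
    simp only [hmap, Kernel.partialTraj_self]
    exact TVTendsto.const _
  | succ b ih =>
    have hsucc (η : Kernel S A) [IsMarkovKernel η] :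
        (M.trajKernel η z).map (Preorder.frestrictLe (b + 1)) =
          ((M.trajKernel η z).map (Preorder.frestrictLe b) ⊗ₘ M.historyKernel η b).map
            (historySnoc b) := by
      rw [hmap η b, Kernel.partialTraj_compProd_eq_map_traj (Nat.zero_le b),
        Measure.map_map (measurable_historySnoc b) (by fun_prop)]
      congr 1
      ext w i : 2
      by_cases hi : i.1 ≤ b
      · simp [historySnoc, hi]
      · have : i.1 = b + 1 := le_antisymm (Finset.mem_Iic.1 i.2) (by omega)
        simp [historySnoc, this]
    simp only [hsucc]
    have hprob (η : Kernel S A) [IsMarkovKernel η] :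
        IsProbabilityMeasure ((M.trajKernel η z).map
          (Preorder.frestrictLe (π := fun _ => S × A) b)) :=
      Measure.isProbabilityMeasure_map (by fun_prop)
    exact (ih.compProd fun w => M.tvTendsto_stepKernel πs π h _).map (measurable_historySnoc b)

/-- The discounted return of the first `n` steps. -/
noncomputable def truncatedReturn (M : MDP S A) (n : ℕ) (w : ℕ → S × A) : ℝ :=
  ∑ t ∈ Finset.range n, M.γ ^ t * M.r (w t)

theorem measurable_truncatedReturn (M : MDP S A) (n : ℕ) : Measurable (M.truncatedReturn n) :=
  Finset.measurable_sum _ fun t _ =>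
    (M.measurable_r.comp (measurable_pi_apply t)).const_mul _

/-! ### Bounds on discounted and truncated returns -/

theorem abs_discounted_reward_le (M : MDP S A) {C : ℝ} (hC : ∀ z, |M.r z| ≤ C)
    (w : ℕ → S × A) (t : ℕ) :
    |M.γ ^ t * M.r (w t)| ≤ C * M.γ ^ t := by
  have hγ : 0 ≤ M.γ ^ t := pow_nonneg M.γ_pos.le _
  rw [abs_mul, abs_of_nonneg hγ, mul_comm]
  exact mul_le_mul_of_nonneg_right (hC _) hγ

theorem hasSum_discounted_bound (M : MDP S A) (C : ℝ) :
    HasSum (fun t => C * M.γ ^ t) (C / (1 - M.γ)) :=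
  (hasSum_geometric_of_lt_one M.γ_pos.le M.γ_lt_one).mul_left C

theorem summable_discounted_reward (M : MDP S A) {C : ℝ} (hC : ∀ z, |M.r z| ≤ C)
    (w : ℕ → S × A) : Summable fun t => M.γ ^ t * M.r (w t) :=
  Summable.of_norm_bounded (M.hasSum_discounted_bound C).summable
    (M.abs_discounted_reward_le hC w)

theorem abs_discountedReturn_le (M : MDP S A) {C : ℝ} (hC : ∀ z, |M.r z| ≤ C)
    (w : ℕ → S × A) : |M.discountedReturn w| ≤ C / (1 - M.γ) := by
  rw [← Real.norm_eq_abs]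
  exact tsum_of_norm_bounded (M.hasSum_discounted_bound C) (M.abs_discounted_reward_le hC w)

theorem abs_truncatedReturn_le (M : MDP S A) {C : ℝ} (hC : ∀ z, |M.r z| ≤ C)
    (n : ℕ) (w : ℕ → S × A) :
    |M.truncatedReturn n w| ≤ C / (1 - M.γ) := by
  have hC0 : 0 ≤ C := (abs_nonneg _).trans (hC (w 0))
  calc _ ≤ ∑ t ∈ Finset.range n, |M.γ ^ t * M.r (w t)| := Finset.abs_sum_le_sum_abs _ _
    _ ≤ ∑ t ∈ Finset.range n, C * M.γ ^ t :=
        Finset.sum_le_sum fun t _ => M.abs_discounted_reward_le hC w t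
    _ ≤ _ := sum_le_hasSum _ (fun t _ => mul_nonneg hC0 (pow_nonneg M.γ_pos.le _))
        (M.hasSum_discounted_bound C)

/-- Geometric tail. The bound does not depend on `w`, so finite-horizon convergence is enough. -/
theorem abs_discountedReturn_sub_truncatedReturn_le (M : MDP S A) {C : ℝ} (hC : ∀ z, |M.r z| ≤ C)
    (n : ℕ) (w : ℕ → S × A) :
    |M.discountedReturn w - M.truncatedReturn n w| ≤ C / (1 - M.γ) * M.γ ^ n := by
  have h1 : M.discountedReturn w - M.truncatedReturn n w =
      ∑' t, M.γ ^ (t + n) * M.r (w (t + n)) := by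
    rw [discountedReturn, truncatedReturn,
      ← (M.summable_discounted_reward hC w).sum_add_tsum_nat_add n]
    ring
  rw [h1, ← Real.norm_eq_abs]
  refine tsum_of_norm_bounded (g := fun t => C * M.γ ^ t * M.γ ^ n)
    ((M.hasSum_discounted_bound C).mul_right _) fun t => ?_
  have := M.abs_discounted_reward_le hC w (t + n)
  rwa [pow_add, ← mul_assoc, ← pow_add] at this

theorem measurable_discountedReturn (M : MDP S A) : Measurable M.discountedReturn := by
  obtain ⟨C, hC⟩ := M.bounded_r
  exact measurable_of_tendsto_metrizable (M.measurable_truncatedReturn) (tendsto_pi_nhds.2 fun w =>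
    (M.summable_discounted_reward hC w).hasSum.tendsto_sum_nat)

theorem returnDist_apply (M : MDP S A) (π : Kernel S A) [IsMarkovKernel π] (z : S × A) :
    M.returnDist π z = (M.trajKernel π z).map M.discountedReturn :=
  Kernel.map_apply _ M.measurable_discountedReturn z

/-- Pointwise convergence of policies in total variation implies convergence of the return
distributions in Wasserstein distance. -/
theorem tendsto_wasserstein_returnDist {ι : Type*} {l : Filter ι} [l.IsCountablyGenerated]
    (M : MDP S A) (πs : ι → Kernel S A) (π : Kernel S A) [∀ i, IsMarkovKernel (πs i)]
    [IsMarkovKernel π] (h : ∀ x, TVTendsto l (fun i => πs i x) (π x)) (z : S × A)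
    {p : ℝ} (hp : 0 < p) :
    Tendsto (fun i => wasserstein p (M.returnDist (πs i) z) (M.returnDist π z)) l (𝓝 0) := by
  obtain ⟨C, hC⟩ := M.bounded_r
  simp only [returnDist_apply]
  refine tendsto_wasserstein_map _ _ M.measurable_discountedReturn
    (M.abs_discountedReturn_le hC) (fun ε hε => ?_) hp
  have hlim : Tendsto (fun n => C / (1 - M.γ) * M.γ ^ n) atTop (𝓝 0) := by
    simpa using (tendsto_pow_atTop_nhds_zero_of_lt_one M.γ_pos.le M.γ_lt_one).const_mul
      (C / (1 - M.γ))
  obtain ⟨n, hn⟩ := (hlim.eventually (gt_mem_nhds hε)).exists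
  refine ⟨M.truncatedReturn n, M.measurable_truncatedReturn n, M.abs_truncatedReturn_le hC n,
    fun w => (M.abs_discountedReturn_sub_truncatedReturn_le hC n w).trans hn.le, fun s hs => ?_⟩
  -- A history up to time `n` has coordinates `0, …, n`, one more than the truncated return reads;
  -- the `if` discards the last.
  let T : ((i : Finset.Iic n) → S × A) → ℝ := fun v =>
    ∑ t : Finset.Iic n, if t.1 < n then M.γ ^ t.1 * M.r (v t) else 0
  have hT : Measurable T := Finset.measurable_sum _ fun t _ => by
    split_ifs
    · exact (M.measurable_r.comp (measurable_pi_apply t)).const_mul _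
    · exact measurable_const
  have hTr : M.truncatedReturn n = T ∘ Preorder.frestrictLe n := by
    ext w
    simp only [truncatedReturn, T, Function.comp, Preorder.frestrictLe_apply]
    rw [Finset.sum_coe_sort (Finset.Iic n)
      (fun t => if t < n then M.γ ^ t * M.r (w t) else 0), ← Finset.sum_filter]
    congr 1
    ext t
    simp
    omega
  have hconv := (M.tvTendsto_trajKernel_frestrictLe πs π h z n).tendsto_measureReal (hT hs)
  have hfr : Measurable (Preorder.frestrictLe (π := fun _ => S × A) n) := by fun_prop
  simp only [map_measureReal_apply hfr (hT hs)] at hconv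
  rw [hTr]
  exact hconv

theorem tendsto_integratedWasserstein_returnDist {ι : Type*} {l : Filter ι}
    [l.IsCountablyGenerated] (M : MDP S A) (πs : ι → Kernel S A) (π : Kernel S A)
    [∀ i, IsMarkovKernel (πs i)] [IsMarkovKernel π]
    (h : ∀ x, TVTendsto l (fun i => πs i x) (π x)) {p p' : ℝ} (hp : 0 < p) (hp' : 0 < p')
    (ω : Measure (S × A)) [IsProbabilityMeasure ω] :
    Tendsto (fun i => integratedWasserstein p p' ω (M.returnDist (πs i)) (M.returnDist π)) l
      (𝓝 0) := by
  obtain ⟨C, hC⟩ := M.bounded_r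
  refine tendsto_integratedWasserstein ω _ _ hp' (K := ENNReal.ofReal (2 * (C / (1 - M.γ))))
    ENNReal.ofReal_ne_top (fun i z => ?_) fun z => M.tendsto_wasserstein_returnDist πs π h z hp
  rw [returnDist_apply, returnDist_apply]
  exact wasserstein_map_le _ _ M.measurable_discountedReturn (M.abs_discountedReturn_le hC) hp

end MDP

/-! ### Essential suprema of bounded functions -/

section EssSup

variable {X : Type*} [MeasurableSpace X] {μ : Measure X}

theorem isBoundedUnder_ae_of_abs_le {f : X → ℝ} {C : ℝ} (hC : ∀ x, |f x| ≤ C) :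
    IsBoundedUnder (· ≤ ·) (ae μ) f :=
  isBoundedUnder_of ⟨C, fun x => (abs_le.1 (hC x)).2⟩

theorem ae_le_essSup_of_abs_le {f : X → ℝ} {C : ℝ} (hC : ∀ x, |f x| ≤ C) :
    ∀ᵐ x ∂μ, f x ≤ essSup f μ :=
  ae_le_essSup (isBoundedUnder_ae_of_abs_le hC)

variable [IsProbabilityMeasure μ]

theorem isCoboundedUnder_ae_of_abs_le {f : X → ℝ} {C : ℝ} (hC : ∀ x, |f x| ≤ C) :
    IsCoboundedUnder (· ≤ ·) (ae μ) f :=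
  IsBoundedUnder.isCoboundedUnder_le (isBoundedUnder_of ⟨-C, fun x => (abs_le.1 (hC x)).1⟩)

/-- In `ℝ` the essential supremum is a limsup in a conditionally complete order. The bound on `f`,
with the nontriviality of `ae μ`, keeps it away from default values. -/
theorem essSup_le_iff_of_abs_le {f : X → ℝ} {C : ℝ} (hC : ∀ x, |f x| ≤ C) {c : ℝ} :
    essSup f μ ≤ c ↔ ∀ᵐ x ∂μ, f x ≤ c :=
  ⟨fun h => (ae_le_essSup_of_abs_le hC).mono fun _ hx => hx.trans h,
    fun h => essSup_le_of_ae_le c h (isCoboundedUnder_ae_of_abs_le hC)⟩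

theorem abs_essSup_sub_le {f g : X → ℝ} {C C' : ℝ} (hf : ∀ x, |f x| ≤ C) (hg : ∀ x, |g x| ≤ C')
    {c : ℝ} (h : ∀ x, |f x - g x| ≤ c) : |essSup f μ - essSup g μ| ≤ c := by
  have h1 : essSup f μ ≤ essSup g μ + c := (essSup_le_iff_of_abs_le hf).2 <| by
    filter_upwards [ae_le_essSup_of_abs_le (μ := μ) hg] with x hx
    linarith [(abs_le.1 (h x)).2]
  have h2 : essSup g μ ≤ essSup f μ + c := (essSup_le_iff_of_abs_le hg).2 <| by
    filter_upwards [ae_le_essSup_of_abs_le (μ := μ) hf] with x hx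
    linarith [(abs_le.1 (h x)).1]
  exact abs_le.2 ⟨by linarith, by linarith⟩

end EssSup

namespace MDP

variable {S A : Type*} [MeasurableSpace S] [MeasurableSpace A]

/-! ### Bellman operators built from a nonexpansive state-value operator -/

/-- The Bellman operator with state-value operator `V`. -/
noncomputable def bellman (M : MDP S A) (V : (S × A → ℝ) → S → ℝ) (q : S × A → ℝ) (z : S × A) :
    ℝ :=
  M.r z + M.γ * ∫ x', V q x' ∂(M.P z)

/-- A state-value operator that preserves measurability, is nonexpansive for the supremum
distance on bounded measurable functions, and vanishes at zero. -/
structure IsValueOperator (V : (S × A → ℝ) → S → ℝ) : Prop where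
  measurable : ∀ q, Measurable q → (∃ C : ℝ, ∀ z, |q z| ≤ C) → Measurable (V q)
  nonexpansive : ∀ q q', Measurable q → Measurable q' → (∃ C : ℝ, ∀ z, |q z| ≤ C) →
    (∃ C : ℝ, ∀ z, |q' z| ≤ C) → ∀ c, (∀ z, |q z - q' z| ≤ c) → ∀ x, |V q x - V q' x| ≤ c
  map_zero : ∀ x, V (fun _ => 0) x = 0

namespace IsValueOperator

variable {V : (S × A → ℝ) → S → ℝ}

theorem abs_le (hV : IsValueOperator V) {q : S × A → ℝ} (hq : Measurable q) {C : ℝ}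
    (hC : ∀ z, |q z| ≤ C) (x : S) : |V q x| ≤ C := by
  have := hV.nonexpansive q (fun _ => 0) hq measurable_const ⟨C, hC⟩ ⟨0, by simp⟩ C
    (by simpa using hC) x
  simpa [hV.map_zero] using this

theorem measurable_bellman (hV : IsValueOperator V) (M : MDP S A) {q : S × A → ℝ}
    (hq : Measurable q) (hb : ∃ C : ℝ, ∀ z, |q z| ≤ C) : Measurable (M.bellman V q) :=
  M.measurable_r.add
    ((hV.measurable q hq hb).stronglyMeasurable.integral_kernel.measurable.const_mul _)

theorem abs_bellman_le (hV : IsValueOperator V) (M : MDP S A) {q : S × A → ℝ}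
    (hq : Measurable q) {C R : ℝ} (hr : ∀ z, |M.r z| ≤ R) (hC : ∀ z, |q z| ≤ C) (z : S × A) :
    |M.bellman V q z| ≤ R + M.γ * C := by
  refine (abs_add_le _ _).trans (add_le_add (hr z) ?_)
  rw [abs_mul, abs_of_pos M.γ_pos]
  exact mul_le_mul_of_nonneg_left (abs_integral_le_of_abs_le (hV.abs_le hq hC)) M.γ_pos.le

theorem abs_bellman_sub_le (hV : IsValueOperator V) (M : MDP S A) {q q' : S × A → ℝ}
    (hq : Measurable q) (hq' : Measurable q') (hb : ∃ C : ℝ, ∀ z, |q z| ≤ C)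
    (hb' : ∃ C : ℝ, ∀ z, |q' z| ≤ C) {c : ℝ} (hc : ∀ z, |q z - q' z| ≤ c) (z : S × A) :
    |M.bellman V q z - M.bellman V q' z| ≤ M.γ * c := by
  obtain ⟨C, hC⟩ := hb
  obtain ⟨C', hC'⟩ := hb'
  have : M.bellman V q z - M.bellman V q' z = M.γ * ∫ x, (V q x - V q' x) ∂(M.P z) := by
    rw [integral_sub
      (integrable_of_measurable_of_abs_le (hV.measurable q hq ⟨C, hC⟩) (hV.abs_le hq hC))
      (integrable_of_measurable_of_abs_le (hV.measurable q' hq' ⟨C', hC'⟩) (hV.abs_le hq' hC')),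
      bellman, bellman]
    ring
  rw [this, abs_mul, abs_of_pos M.γ_pos]
  exact mul_le_mul_of_nonneg_left (abs_integral_le_of_abs_le
    (hV.nonexpansive q q' hq hq' ⟨C, hC⟩ ⟨C', hC'⟩ c hc)) M.γ_pos.le

/-- Banach iteration from zero, carried out pointwise. Pointwise limits preserve measurability,
while the geometric rate, uniform in `z`, allows passage to the limit inside the operator. -/
theorem exists_isBddFixedPoint (hV : IsValueOperator V) (M : MDP S A) :
    ∃ q, IsBddFixedPoint (M.bellman V) q := by
  obtain ⟨R, hR⟩ := M.bounded_r
  have hγ := M.γ_lt_one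
  have hγ' : (1 - M.γ) ≠ 0 := by linarith
  set qs : ℕ → S × A → ℝ := fun n => (M.bellman V)^[n] fun _ => 0 with hqs
  have hsucc (n : ℕ) : qs (n + 1) = M.bellman V (qs n) := Function.iterate_succ_apply' _ _ _
  -- The bound is invariant because `R + γ R / (1 - γ) = R / (1 - γ)`.
  have hbm (n : ℕ) : Measurable (qs n) ∧ ∀ z, |qs n z| ≤ R / (1 - M.γ) := by
    induction n with
    | zero =>
      refine ⟨measurable_const, fun z => ?_⟩
      have : 0 ≤ R := (abs_nonneg _).trans (hR z)
      simp only [hqs, Function.iterate_zero, id, abs_zero]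
      exact div_nonneg this (by linarith)
    | succ n ih =>
      rw [hsucc]
      refine ⟨hV.measurable_bellman M ih.1 ⟨_, ih.2⟩, fun z => ?_⟩
      refine (hV.abs_bellman_le M ih.1 hR ih.2 z).trans (le_of_eq ?_)
      field_simp
      ring
  have hstep (n : ℕ) (z : S × A) : |qs n z - qs (n + 1) z| ≤ R * M.γ ^ n := by
    induction n generalizing z with
    | zero =>
      have := hV.abs_bellman_le M (q := fun _ => 0) measurable_const hR (C := 0) (by simp) z
      simpa [hqs, abs_sub_comm] using this
    | succ n ih =>
      rw [hsucc (n + 1), hsucc n]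
      refine (hV.abs_bellman_sub_le M (hbm n).1 (hsucc n ▸ (hbm (n + 1)).1) ⟨_, (hbm n).2⟩
        ⟨_, hsucc n ▸ (hbm (n + 1)).2⟩ (c := R * M.γ ^ n) (fun z => ?_) z).trans (le_of_eq ?_)
      · rw [← hsucc n]; exact ih z
      · ring
  have hcauchy (z : S × A) : CauchySeq fun n => qs n z :=
    cauchySeq_of_le_geometric M.γ R hγ fun n => hstep n z
  choose q hq using fun z => cauchySeq_tendsto_of_complete (hcauchy z)
  have hqm : Measurable q := measurable_of_tendsto_metrizable (fun n => (hbm n).1)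
    (tendsto_pi_nhds.2 hq)
  have hqb (z : S × A) : |q z| ≤ R / (1 - M.γ) :=
    le_of_tendsto (hq z).abs (Eventually.of_forall fun n => (hbm n).2 z)
  have hdist (n : ℕ) (z : S × A) : |qs n z - q z| ≤ R * M.γ ^ n / (1 - M.γ) :=
    dist_le_of_le_geometric_of_tendsto M.γ R hγ (fun n => hstep n z) (hq z) n
  refine ⟨q, hqm, ⟨_, hqb⟩, funext fun z => ?_⟩
  have h1 : Tendsto (fun n => M.γ * (R * M.γ ^ n / (1 - M.γ))) atTop (𝓝 0) := by
    simpa using (((tendsto_pow_atTop_nhds_zero_of_lt_one M.γ_pos.le hγ).const_mul R).div_const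
      (1 - M.γ)).const_mul M.γ
  have h2 : Tendsto (fun n => qs (n + 1) z) atTop (𝓝 (M.bellman V q z)) := by
    rw [tendsto_iff_norm_sub_tendsto_zero]
    refine squeeze_zero (fun _ => norm_nonneg _) (fun n => ?_) h1
    rw [hsucc]
    exact hV.abs_bellman_sub_le M (hbm n).1 hqm ⟨_, (hbm n).2⟩ ⟨_, hqb⟩ (hdist n) z
  exact tendsto_nhds_unique h2 ((tendsto_add_atTop_iff_nat 1).2 (hq z))

end IsValueOperator

/-! ### The two value operators -/

/-- The essential supremum is at most `c` exactly where the section of `{c < q}` is null, and the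
kernel mass of a section is measurable in the base point. -/
theorem measurable_essSup {πref : Kernel S A} [IsMarkovKernel πref] {q : S × A → ℝ}
    (hq : Measurable q) (hb : ∃ C : ℝ, ∀ z, |q z| ≤ C) :
    Measurable fun x => essSup (fun a => q (x, a)) (πref x) := by
  obtain ⟨C, hC⟩ := hb
  refine measurable_of_Iic fun c => ?_
  have : (fun x => essSup (fun a => q (x, a)) (πref x)) ⁻¹' Set.Iic c =
      (fun x => πref x (Prod.mk x ⁻¹' {z | c < q z})) ⁻¹' {0} := by
    ext x
    simp only [Set.mem_preimage, Set.mem_Iic, Set.mem_singleton_iff,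
      essSup_le_iff_of_abs_le (fun a => hC (x, a)), ae_iff, not_le]
    rfl
  rw [this]
  exact Kernel.measurable_kernel_prodMk_left (measurableSet_lt measurable_const hq)
    (measurableSet_singleton 0)

theorem isValueOperator_essSup (πref : Kernel S A) [IsMarkovKernel πref] :
    IsValueOperator fun (q : S × A → ℝ) x => essSup (fun a => q (x, a)) (πref x) where
  measurable _ hq hb := measurable_essSup hq hb
  nonexpansive _ _ _ _ hb hb' _ h x := by
    obtain ⟨C, hC⟩ := hb
    obtain ⟨C', hC'⟩ := hb'
    exact abs_essSup_sub_le (fun a => hC _) (fun a => hC' _) fun a => h (x, a)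
  map_zero x := essSup_const' 0

/-! ### The log-sum-exp value operator -/

theorem integrable_exp_div {μ : Measure A} [IsProbabilityMeasure μ] {f : A → ℝ}
    (hf : Measurable f) {C : ℝ} (hC : ∀ a, |f a| ≤ C) {τ : ℝ} (hτ : 0 < τ) :
    Integrable (fun a => Real.exp (f a / τ)) μ := by
  refine integrable_of_measurable_of_abs_le (C := Real.exp (C / τ)) (by fun_prop) fun a => ?_
  rw [abs_of_pos (Real.exp_pos _)]
  exact Real.exp_le_exp.2 (div_le_div_of_nonneg_right (abs_le.1 (hC a)).2 hτ.le)

/-- Log-sum-exp is monotone and commutes with adding constants; applied in both directions, this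
gives nonexpansiveness. -/
theorem vLSE_le_add {πref : Kernel S A} [IsMarkovKernel πref] {τ : ℝ} (hτ : 0 < τ)
    {q q' : S × A → ℝ} (hq : Measurable q) (hq' : Measurable q') {C C' : ℝ}
    (hC : ∀ z, |q z| ≤ C) (hC' : ∀ z, |q' z| ≤ C') {c : ℝ} (h : ∀ z, q z ≤ q' z + c) (x : S) :
    vLSE πref τ q x ≤ vLSE πref τ q' x + c := by
  have hi : Integrable (fun a => Real.exp (q (x, a) / τ)) (πref x) :=
    integrable_exp_div (hq.comp measurable_prodMk_left)
      (fun a => hC (x, a)) hτ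
  have hi' : Integrable (fun a => Real.exp (q' (x, a) / τ)) (πref x) :=
    integrable_exp_div (hq'.comp measurable_prodMk_left)
      (fun a => hC' (x, a)) hτ
  have hle : ∫ a, Real.exp (q (x, a) / τ) ∂(πref x) ≤
      Real.exp (c / τ) * ∫ a, Real.exp (q' (x, a) / τ) ∂(πref x) := by
    rw [← integral_const_mul]
    refine integral_mono hi (hi'.const_mul _) fun a => ?_
    dsimp only
    rw [← Real.exp_add, ← add_div]
    exact Real.exp_le_exp.2 (div_le_div_of_nonneg_right (by linarith [h (x, a)]) hτ.le)
  have hlog := Real.log_le_log (integral_exp_pos hi) hle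
  rw [Real.log_mul (Real.exp_ne_zero _) (integral_exp_pos hi').ne', Real.log_exp] at hlog
  have := mul_le_mul_of_nonneg_left hlog hτ.le
  rw [mul_add, mul_div_cancel₀ _ hτ.ne'] at this
  unfold vLSE
  linarith

theorem measurable_vLSE {πref : Kernel S A} [IsMarkovKernel πref] (τ : ℝ) {q : S × A → ℝ}
    (hq : Measurable q) : Measurable (vLSE πref τ q) := by
  have h : Measurable fun z : S × A => Real.exp (q z / τ) := by fun_prop
  exact (Real.measurable_log.comp
    h.stronglyMeasurable.integral_kernel_prod_right'.measurable).const_mul τ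

theorem isValueOperator_vLSE (πref : Kernel S A) [IsMarkovKernel πref] {τ : ℝ} (hτ : 0 < τ) :
    IsValueOperator (vLSE πref τ) where
  measurable _ hq _ := measurable_vLSE τ hq
  nonexpansive q q' hq hq' hb hb' c h x := by
    obtain ⟨C, hC⟩ := hb
    obtain ⟨C', hC'⟩ := hb'
    have h1 := vLSE_le_add hτ hq hq' hC hC' (πref := πref) (c := c)
      (fun z => by linarith [(abs_le.1 (h z)).2]) x
    have h2 := vLSE_le_add hτ hq' hq hC' hC (πref := πref) (c := c)
      (fun z => by linarith [(abs_le.1 (h z)).1]) x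
    exact abs_le.2 ⟨by linarith, by linarith⟩
  map_zero x := by simp [vLSE]

/-- `softBellman` unfolds to `bellman` for the log-sum-exp operator, so the general existence result
applies. Uniqueness plays no role: later estimates hold for whichever fixed point is chosen. -/
theorem isBddFixedPoint_qSoft (M : MDP S A) (πref : Kernel S A) [IsMarkovKernel πref] {τ : ℝ}
    (hτ : 0 < τ) : IsBddFixedPoint (M.softBellman πref τ) (M.qSoft πref τ) :=
  Classical.epsilon_spec ((isValueOperator_vLSE πref hτ).exists_isBddFixedPoint M)

theorem isBddFixedPoint_qRef (M : MDP S A) (πref : Kernel S A) [IsMarkovKernel πref] :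
    IsBddFixedPoint (M.refBellman πref) (M.qRef πref) :=
  Classical.epsilon_spec ((isValueOperator_essSup πref).exists_isBddFixedPoint M)

theorem vLSE_le_essSup {πref : Kernel S A} [IsMarkovKernel πref] {τ : ℝ} (hτ : 0 < τ)
    {q : S × A → ℝ} (hq : Measurable q) {C : ℝ} (hC : ∀ z, |q z| ≤ C) (x : S) :
    vLSE πref τ q x ≤ essSup (fun a => q (x, a)) (πref x) := by
  set e := essSup (fun a => q (x, a)) (πref x)
  have hi : Integrable (fun a => Real.exp (q (x, a) / τ)) (πref x) :=
    integrable_exp_div (hq.comp measurable_prodMk_left)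
      (fun a => hC (x, a)) hτ
  have hle : ∫ a, Real.exp (q (x, a) / τ) ∂(πref x) ≤ Real.exp (e / τ) := by
    have : ∫ a, Real.exp (q (x, a) / τ) ∂(πref x) ≤ ∫ _, Real.exp (e / τ) ∂(πref x) := by
      refine integral_mono_ae hi (integrable_const _) ?_
      filter_upwards [ae_le_essSup_of_abs_le (μ := πref x) fun a => hC (x, a)] with a ha
      exact Real.exp_le_exp.2 (div_le_div_of_nonneg_right ha hτ.le)
    simpa using this
  have hlog := Real.log_le_log (integral_exp_pos hi) hle
  rw [Real.log_exp] at hlog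
  have := mul_le_mul_of_nonneg_left hlog hτ.le
  rwa [mul_div_cancel₀ _ hτ.ne'] at this

theorem measurableSet_optActions (πref : Kernel S A) {q : S × A → ℝ} (hq : Measurable q) (x : S) :
    MeasurableSet (optActions πref q x) :=
  measurableSet_eq_fun (hq.comp measurable_prodMk_left) measurable_const

/-- Restricting the integral to the maximizers leaves mass at least `δ` at height `exp (e / τ)`;
after taking logarithms the loss is linear in `τ`. -/
theorem essSup_add_log_le_vLSE {πref : Kernel S A} [IsMarkovKernel πref] {τ : ℝ} (hτ : 0 < τ)
    {q : S × A → ℝ} (hq : Measurable q) {C : ℝ} (hC : ∀ z, |q z| ≤ C) {x : S} {δ : ℝ}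
    (hδ : 0 < δ) (h : δ ≤ (πref x).real (optActions πref q x)) :
    essSup (fun a => q (x, a)) (πref x) + τ * Real.log δ ≤ vLSE πref τ q x := by
  set e := essSup (fun a => q (x, a)) (πref x) with he
  have hqx : Measurable fun a => q (x, a) := hq.comp measurable_prodMk_left
  have hi := integrable_exp_div (μ := πref x) hqx (fun a => hC (x, a)) hτ
  have hO := measurableSet_optActions πref hq x
  have hle : Real.exp (e / τ) * δ ≤ ∫ a, Real.exp (q (x, a) / τ) ∂(πref x) := by
    calc Real.exp (e / τ) * δ ≤ Real.exp (e / τ) * (πref x).real (optActions πref q x) :=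
          mul_le_mul_of_nonneg_left h (Real.exp_pos _).le
      _ = ∫ a in optActions πref q x, Real.exp (e / τ) ∂(πref x) := by
          rw [setIntegral_const, smul_eq_mul, mul_comm]
      _ = ∫ a in optActions πref q x, Real.exp (q (x, a) / τ) ∂(πref x) :=
          setIntegral_congr_fun hO fun a (ha : q (x, a) = e) => by simp only [ha]
      _ ≤ _ := setIntegral_le_integral hi (ae_of_all _ fun _ => (Real.exp_pos _).le)
  have hlog := Real.log_le_log (by positivity) hle
  rw [Real.log_mul (Real.exp_ne_zero _) hδ.ne', Real.log_exp] at hlog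
  have := mul_le_mul_of_nonneg_left hlog hτ.le
  rwa [mul_add, mul_div_cancel₀ _ hτ.ne'] at this

/-- Under coverage the soft action values converge uniformly to the reference-optimal action values,
at a rate linear in the temperature. -/
theorem exists_abs_qSoft_sub_qRef_le (M : MDP S A) (πref : Kernel S A) [IsMarkovKernel πref]
    (hcov : M.Coverage πref) :
    ∃ K : ℝ, 0 ≤ K ∧ ∀ τ : ℝ, 0 < τ → ∀ z, |M.qSoft πref τ z - M.qRef πref z| ≤ K * τ := by
  obtain ⟨pmin, hpos, hp⟩ := hcov
  -- Without states coverage is vacuous and `pmin` may be infinite; one state forces `pmin ≤ 1`.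
  rcases isEmpty_or_nonempty S with hS | ⟨⟨x₀⟩⟩
  · exact ⟨0, le_rfl, fun _ _ z => hS.elim z.1⟩
  have hp1 : pmin ≤ 1 := (hp 1 one_pos x₀).trans prob_le_one
  have hptop : pmin ≠ ∞ := ne_top_of_le_ne_top ENNReal.one_ne_top hp1
  set δ := pmin.toReal with hδ
  have hδ0 : 0 < δ := ENNReal.toReal_pos hpos.ne' hptop
  have hδ1 : δ ≤ 1 := ENNReal.toReal_le_of_le_ofReal zero_le_one (by simpa using hp1)
  have hL : 0 ≤ -Real.log δ := neg_nonneg.2 (Real.log_nonpos hδ0.le hδ1)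
  have hγ : 0 < 1 - M.γ := by linarith [M.γ_lt_one]
  -- The constant solves `D ≤ γ (τ (-log δ) + D)` for the supremum distance `D`, finite because both
  -- functions are bounded.
  refine ⟨M.γ * -Real.log δ / (1 - M.γ), div_nonneg (mul_nonneg M.γ_pos.le hL) hγ.le,
    fun τ hτ z => ?_⟩
  obtain ⟨hqm, ⟨C, hC⟩, hqfix⟩ := M.isBddFixedPoint_qSoft πref hτ
  obtain ⟨hrm, ⟨C', hC'⟩, hrfix⟩ := M.isBddFixedPoint_qRef πref
  set q := M.qSoft πref τ
  set q' := M.qRef πref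
  have hbdd : BddAbove (Set.range fun z => |q z - q' z|) := by
    refine ⟨C + C', ?_⟩
    rintro _ ⟨z, rfl⟩
    exact (abs_sub _ _).trans (add_le_add (hC z) (hC' z))
  set D := ⨆ z, |q z - q' z| with hD
  have hDle (z : S × A) : |q z - q' z| ≤ D := le_ciSup hbdd z
  have hV (x : S) : |vLSE πref τ q x - essSup (fun a => q' (x, a)) (πref x)| ≤
      τ * -Real.log δ + D := by
    have h1 := vLSE_le_essSup (πref := πref) hτ hqm hC x
    have h2 := essSup_add_log_le_vLSE (πref := πref) hτ hqm hC (x := x) hδ0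
      (ENNReal.toReal_mono (measure_ne_top _ _) (hp τ hτ x))
    have h3 := abs_le.1 (abs_essSup_sub_le (μ := πref x) (fun a => hC (x, a))
      (fun a => hC' (x, a)) fun a => hDle (x, a))
    have h4 := mul_nonneg hτ.le hL
    exact abs_le.2 ⟨by linarith, by linarith⟩
  have hstep (z : S × A) : |q z - q' z| ≤ M.γ * (τ * -Real.log δ + D) := by
    have hi1 : Integrable (vLSE πref τ q) (M.P z) := integrable_of_measurable_of_abs_le
      (measurable_vLSE τ hqm) ((isValueOperator_vLSE πref hτ).abs_le hqm hC)
    have hi2 : Integrable (fun x => essSup (fun a => q' (x, a)) (πref x)) (M.P z) :=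
      integrable_of_measurable_of_abs_le (measurable_essSup hrm ⟨C', hC'⟩)
        ((isValueOperator_essSup πref).abs_le hrm hC')
    have : q z - q' z =
        M.γ * ∫ x, (vLSE πref τ q x - essSup (fun a => q' (x, a)) (πref x)) ∂(M.P z) := by
      rw [integral_sub hi1 hi2]
      conv_lhs => rw [← hqfix, ← hrfix]
      simp only [softBellman, refBellman]
      ring
    rw [this, abs_mul, abs_of_pos M.γ_pos]
    exact mul_le_mul_of_nonneg_left (abs_integral_le_of_abs_le hV) M.γ_pos.le
  have : Nonempty (S × A) := ⟨z⟩
  have hDD : D ≤ M.γ * (τ * -Real.log δ + D) := ciSup_le hstep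
  refine (hDle z).trans ?_
  rw [div_mul_eq_mul_div, le_div_iff₀ hγ]
  linarith

end MDP

namespace MDP

variable {S A : Type*} [MeasurableSpace S] [MeasurableSpace A]

/-! ### Convergence of policies -/

theorem toPolicy_apply_of_measure_univ (πref κ : Kernel S A) {x : S} (h : κ x Set.univ = 1) :
    toPolicy πref κ x = κ x := by
  classical
  unfold toPolicy
  rw [Kernel.piecewise_apply, if_pos]
  exact h

/-- The Boltzmann–Gibbs density, computed relative to an arbitrary baseline `e`. -/
theorem exp_sub_vLSE_div {πref : Kernel S A} [IsMarkovKernel πref] {τ : ℝ} (hτ : 0 < τ)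
    {q : S × A → ℝ} (hq : Measurable q) {C : ℝ} (hC : ∀ z, |q z| ≤ C) (x : S) (e : ℝ) (a : A) :
    Real.exp ((q (x, a) - vLSE πref τ q x) / τ) =
      Real.exp ((q (x, a) - e) / τ) / ∫ b, Real.exp ((q (x, b) - e) / τ) ∂(πref x) := by
  have hi : Integrable (fun a => Real.exp (q (x, a) / τ)) (πref x) :=
    integrable_exp_div (hq.comp measurable_prodMk_left) (fun a => hC (x, a)) hτ
  have hZ := integral_exp_pos hi
  have h1 : Real.exp (vLSE πref τ q x / τ) = ∫ b, Real.exp (q (x, b) / τ) ∂(πref x) := by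
    rw [vLSE, mul_div_cancel_left₀ _ hτ.ne', Real.exp_log hZ]
  simp only [sub_div, Real.exp_sub, integral_div, h1]
  field_simp

/-- The total mass is one, so the fallback in `toPolicy` is never taken. The baseline `e` cancels in
the quotient; taking it to be the limiting essential supremum keeps the exponents bounded above as
`τ` vanishes. -/
theorem boltzmann_apply {πref : Kernel S A} [IsMarkovKernel πref] {τ : ℝ} (hτ : 0 < τ)
    {q : S × A → ℝ} (hq : Measurable q) {C : ℝ} (hC : ∀ z, |q z| ≤ C) (x : S) (e : ℝ) :
    boltzmann πref τ q x = (πref x).withDensity fun a => ENNReal.ofReal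
      (Real.exp ((q (x, a) - e) / τ) / ∫ b, Real.exp ((q (x, b) - e) / τ) ∂(πref x)) := by
  have hm : Measurable (Function.uncurry fun (x : S) (a : A) =>
      ENNReal.ofReal (Real.exp ((q (x, a) - vLSE πref τ q x) / τ))) :=
    (Real.measurable_exp.comp
      ((hq.sub ((measurable_vLSE τ hq).comp measurable_fst)).div_const τ)).ennreal_ofReal
  have happ := Kernel.withDensity_apply πref hm x
  have hi : Integrable (fun a => Real.exp (q (x, a) / τ)) (πref x) :=
    integrable_exp_div (hq.comp measurable_prodMk_left) (fun a => hC (x, a)) hτ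
  rw [boltzmann, toPolicy_apply_of_measure_univ, happ]
  · simp_rw [exp_sub_vLSE_div hτ hq hC x e]
  · have hd (a : A) := exp_sub_vLSE_div (πref := πref) hτ hq hC x 0 a
    simp only [sub_zero] at hd
    rw [happ, withDensity_apply _ MeasurableSet.univ, setLIntegral_univ]
    simp_rw [hd]
    rw [← ofReal_integral_eq_lintegral_ofReal (hi.div_const _)
      (ae_of_all _ fun a => div_nonneg (Real.exp_pos _).le (integral_exp_pos hi).le),
      integral_div, div_self (integral_exp_pos hi).ne', ENNReal.ofReal_one]

theorem filteredPolicy_apply {πref : Kernel S A} [IsMarkovKernel πref] {q : S × A → ℝ}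
    (hq : Measurable q) (hb : ∃ C : ℝ, ∀ z, |q z| ≤ C) {x : S}
    (hO : πref x (optActions πref q x) ≠ 0) :
    filteredPolicy πref q x = (πref x).withDensity fun a => ENNReal.ofReal
      ((optActions πref q x).indicator (fun _ => 1) a / (πref x).real (optActions πref q x)) := by
  have hE : MeasurableSet {z : S × A | q z = essSup (fun a => q (z.1, a)) (πref z.1)} :=
    measurableSet_eq_fun hq ((measurable_essSup hq hb).comp measurable_fst)
  have hm : Measurable (Function.uncurry fun (x : S) (a : A) =>
      (πref x (optActions πref q x))⁻¹ *
        (optActions πref q x).indicator (fun _ => (1 : ℝ≥0∞)) a) := by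
    have h1 : Measurable fun x => πref x (optActions πref q x) :=
      Kernel.measurable_kernel_prodMk_left hE
    exact (h1.comp measurable_fst).inv.mul (measurable_const.indicator hE)
  have happ := Kernel.withDensity_apply πref hm x
  have hOm := measurableSet_optActions πref hq x
  rw [filteredPolicy, toPolicy_apply_of_measure_univ, happ]
  · congr 1
    ext a
    have hpos : 0 < (πref x).real (optActions πref q x) :=
      ENNReal.toReal_pos hO (measure_ne_top _ _)
    rw [ENNReal.ofReal_div_of_pos hpos, ofReal_measureReal, mul_comm, div_eq_mul_inv]
    by_cases ha : a ∈ optActions πref q x <;> simp [ha]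
  · rw [happ, withDensity_apply _ MeasurableSet.univ, setLIntegral_univ,
      lintegral_const_mul _ (measurable_const.indicator hOm), lintegral_indicator_const hOm,
      one_mul, ENNReal.inv_mul_cancel hO (measure_ne_top _ _)]

/-- Coverage passes to the limit of vanishing temperature. -/
theorem measure_optActions_qRef_ne_zero (M : MDP S A) (πref : Kernel S A) [IsMarkovKernel πref]
    (hcov : M.Coverage πref) (x : S) : πref x (optActions πref (M.qRef πref) x) ≠ 0 := by
  obtain ⟨K, hK0, hK⟩ := M.exists_abs_qSoft_sub_qRef_le πref hcov
  obtain ⟨pmin, hpos, hp⟩ := hcov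
  obtain ⟨hrm, ⟨C', hC'⟩, -⟩ := M.isBddFixedPoint_qRef πref
  set q := M.qRef πref
  set e := essSup (fun a => q (x, a)) (πref x) with he
  have hqx : Measurable fun a => q (x, a) := hrm.comp measurable_prodMk_left
  -- These superlevel sets decrease, up to a null set, to the optimal actions. Each contains the
  -- maximizers of a sufficiently cold soft value, hence has mass at least `pmin`.
  let E : ℕ → Set A := fun n => {a | e - 1 / ((n : ℝ) + 1) ≤ q (x, a)}
  have hE (n : ℕ) : MeasurableSet (E n) := measurableSet_le measurable_const hqx
  have hanti : Antitone E := fun m n hmn a ha => by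
    have : 1 / ((n : ℝ) + 1) ≤ 1 / ((m : ℝ) + 1) := Nat.one_div_le_one_div hmn
    have ha' : e - 1 / ((n : ℝ) + 1) ≤ q (x, a) := ha
    exact (sub_le_sub_left this e).trans ha'
  have hle (n : ℕ) : pmin ≤ πref x (E n) := by
    have hn : (0 : ℝ) < 1 / ((n : ℝ) + 1) := Nat.one_div_pos_of_nat
    -- The factor 2 pays for the error `K * τ` twice, in the value and in its essential supremum; `K
    -- + 1` keeps the denominator positive.
    set τ : ℝ := 1 / ((n : ℝ) + 1) / (2 * (K + 1)) with hτ
    have hτ0 : 0 < τ := by positivity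
    have hKτ : 2 * (K * τ) ≤ 1 / ((n : ℝ) + 1) := by
      have h1 : 2 * (K + 1) * τ = 1 / ((n : ℝ) + 1) := by
        rw [hτ]; field_simp
      nlinarith
    refine (hp τ hτ0 x).trans (measure_mono fun a ha => ?_)
    obtain ⟨-, ⟨C, hC⟩, -⟩ := M.isBddFixedPoint_qSoft πref hτ0
    have h1 := abs_le.1 (abs_essSup_sub_le (μ := πref x) (fun a => hC (x, a))
      (fun a => hC' (x, a)) fun a => hK τ hτ0 (x, a))
    have h2 := abs_le.1 (hK τ hτ0 (x, a))
    have h3 : M.qSoft πref τ (x, a) = essSup (fun a => M.qSoft πref τ (x, a)) (πref x) := ha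
    change e - 1 / ((n : ℝ) + 1) ≤ q (x, a)
    linarith
  have hlim := tendsto_measure_iInter_atTop (μ := πref x)
    (fun n => (hE n).nullMeasurableSet) hanti ⟨0, measure_ne_top _ _⟩
  have hint : πref x (⋂ n, E n) ≤ πref x (optActions πref q x) := by
    refine measure_mono_ae ?_
    filter_upwards [ae_le_essSup_of_abs_le (μ := πref x) fun a => hC' (x, a)] with a ha hmem
    refine le_antisymm ha ?_
    have h1 : Tendsto (fun n : ℕ => e - 1 / ((n : ℝ) + 1)) atTop (𝓝 (e - 0)) :=
      tendsto_const_nhds.sub tendsto_one_div_add_atTop_nhds_zero_nat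
    rw [sub_zero] at h1
    exact le_of_tendsto' h1 fun n => Set.mem_iInter.1 hmem n
  exact (hpos.trans_le ((ge_of_tendsto' hlim hle).trans hint)).ne'

/-- Along `σ = o(τ)` the decoupled policies converge, at every state and in total variation, to the
reference policy filtered by the reference-optimal action values. -/
theorem tvTendsto_decoupledPolicy (M : MDP S A) (πref : Kernel S A) [IsMarkovKernel πref]
    (hcov : M.Coverage πref) (σ : ℝ → ℝ) (hσpos : ∀ τ, 0 < τ → 0 < σ τ)
    (hσ : Tendsto (fun τ => σ τ / τ) (𝓝[>] 0) (𝓝 0)) (x : S) :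
    TVTendsto (𝓝[>] 0) (fun τ => M.decoupledPolicy πref τ (σ τ) x)
      (filteredPolicy πref (M.qRef πref) x) := by
  obtain ⟨K, hK0, hK⟩ := M.exists_abs_qSoft_sub_qRef_le πref hcov
  have hOne := M.measure_optActions_qRef_ne_zero πref hcov x
  obtain ⟨hrm, ⟨C', hC'⟩, -⟩ := M.isBddFixedPoint_qRef πref
  rw [filteredPolicy_apply hrm ⟨C', hC'⟩ hOne]
  set q := M.qRef πref
  set e := essSup (fun a => q (x, a)) (πref x) with he
  set O := optActions πref q x with hO
  have hOm : MeasurableSet O := measurableSet_optActions πref hrm x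
  have hm : 0 < (πref x).real O := ENNReal.toReal_pos hOne (measure_ne_top _ _)
  set w : ℝ → A → ℝ := fun τ a => Real.exp ((M.qSoft πref (σ τ) (x, a) - e) / τ) with hw
  have hae := ae_le_essSup_of_abs_le (μ := πref x) fun a => hC' (x, a)
  have hposev : ∀ᶠ τ : ℝ in 𝓝[>] 0, 0 < τ := eventually_mem_nhdsWithin
  have hwm : ∀ᶠ τ in 𝓝[>] 0, Measurable (w τ) := hposev.mono fun τ hτ =>
    Real.measurable_exp.comp (((((M.isBddFixedPoint_qSoft πref (hσpos τ hτ)).1).comp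
      measurable_prodMk_left).sub_const e).div_const τ)
  -- Almost everywhere `q ≤ e`, so the exponent is at most `K σ / τ`, hence at most `K` once `σ <
  -- τ`.
  have hwK : ∀ᶠ τ in 𝓝[>] 0, ∀ᵐ a ∂(πref x), w τ a ≤ Real.exp K := by
    filter_upwards [hposev, hσ.eventually (gt_mem_nhds one_pos)] with τ hτ hστ
    filter_upwards [hae] with a ha
    refine Real.exp_le_exp.2 ?_
    have h1 := (abs_le.1 (hK (σ τ) (hσpos τ hτ) (x, a))).2
    rw [div_lt_one hτ] at hστ
    rw [div_le_iff₀ hτ]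
    nlinarith
  have hdiff (a : A) :
      Tendsto (fun τ => (M.qSoft πref (σ τ) (x, a) - q (x, a)) / τ) (𝓝[>] 0) (𝓝 0) := by
    have h1 : Tendsto (fun τ => K * (σ τ / τ)) (𝓝[>] 0) (𝓝 0) := by simpa using hσ.const_mul K
    refine squeeze_zero_norm' ?_ h1
    filter_upwards [hposev] with τ hτ
    rw [Real.norm_eq_abs, abs_div, abs_of_pos hτ, ← mul_div_assoc]
    exact div_le_div_of_nonneg_right (hK _ (hσpos τ hτ) _) hτ.le
  -- On `O` the exponent is only the vanishing error. Off `O` the strict gap `q - e < 0`, divided by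
  -- `τ`, drives it to `-∞`.
  have hwlim : ∀ᵐ a ∂(πref x),
      Tendsto (fun τ => w τ a) (𝓝[>] 0) (𝓝 (O.indicator (fun _ => 1) a)) := by
    filter_upwards [hae] with a ha
    by_cases haO : a ∈ O
    · have h1 : q (x, a) = e := haO
      have h2 := (Real.continuous_exp.tendsto 0).comp (hdiff a)
      rw [Real.exp_zero] at h2
      simpa [hw, haO, h1, Function.comp_def] using h2
    · have hlt : q (x, a) - e < 0 := sub_neg.2 (lt_of_le_of_ne ha haO)
      have h3 : Tendsto (fun τ : ℝ => (q (x, a) - e) / τ) (𝓝[>] 0) atBot := by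
        simpa only [div_eq_mul_inv] using tendsto_inv_nhdsGT_zero.const_mul_atTop_of_neg hlt
      have h4 := Real.tendsto_exp_atBot.comp ((hdiff a).add_atBot h3)
      rw [Set.indicator_of_notMem haO]
      refine h4.congr fun τ => ?_
      simp only [hw, Function.comp]
      congr 1
      ring
  have hZlim : Tendsto (fun τ => ∫ a, w τ a ∂(πref x)) (𝓝[>] 0) (𝓝 ((πref x).real O)) := by
    have h := tendsto_integral_filter_of_dominated_convergence (μ := πref x)
      (F := w) (f := O.indicator fun _ => 1) (fun _ => Real.exp K)
      (hwm.mono fun τ hτ => hτ.aestronglyMeasurable)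
      (hwK.mono fun τ hτ => hτ.mono fun a ha => by
        rwa [Real.norm_eq_abs, abs_of_pos (Real.exp_pos _)])
      (integrable_const _) hwlim
    rwa [integral_indicator_const _ hOm, smul_eq_mul, mul_one] at h
  -- Keeping the normalizer above half its positive limit bounds the normalized densities uniformly.
  have hZhalf : ∀ᶠ τ in 𝓝[>] 0, (πref x).real O / 2 < ∫ a, w τ a ∂(πref x) :=
    hZlim.eventually (lt_mem_nhds (by linarith))
  have hexpK : 1 ≤ Real.exp K := Real.one_le_exp hK0
  have hTV : TVTendsto (𝓝[>] 0)
      (fun τ => (πref x).withDensity fun a => ENNReal.ofReal (w τ a / ∫ b, w τ b ∂(πref x)))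
      ((πref x).withDensity fun a => ENNReal.ofReal
        (O.indicator (fun _ => 1) a / (πref x).real O)) := by
    refine TVTendsto.withDensity (K := Real.exp K / ((πref x).real O / 2))
      (hwm.mono fun τ hτ => hτ.div_const _) ((measurable_const.indicator hOm).div_const _)
      (hZhalf.mono fun τ hτ a => div_nonneg (Real.exp_pos _).le (by linarith))
      (fun a => div_nonneg (Set.indicator_nonneg (fun _ _ => zero_le_one) a) hm.le) ?_
      (ae_of_all _ fun a => ?_) (hwlim.mono fun a ha => ha.div hZlim hm.ne')
    · filter_upwards [hwK, hZhalf] with τ h1 h2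
      filter_upwards [h1] with a ha
      exact div_le_div₀ (Real.exp_pos _).le ha (by linarith) h2.le
    · refine div_le_div₀ (Real.exp_pos _).le (le_trans ?_ hexpK) (by linarith) (by linarith)
      exact Set.indicator_le_self' (fun _ _ => zero_le_one) a
  refine hTV.congr' ?_
  filter_upwards [hposev] with τ hτ
  obtain ⟨hqm, ⟨C, hC⟩, -⟩ := M.isBddFixedPoint_qSoft πref (hσpos τ hτ)
  rw [decoupledPolicy, boltzmann_apply hτ hqm hC x e]

end MDP

theorem mainTheorem2 {S A : Type*} [MeasurableSpace S] [MeasurableSpace A]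
    [Countable A] [DiscreteMeasurableSpace A]
    (M : MDP S A) (πref : Kernel S A) [IsMarkovKernel πref]
    (hcov : M.Coverage πref)
    (σ : ℝ → ℝ) (hσpos : ∀ τ, 0 < τ → 0 < σ τ)
    (hσ : Tendsto (fun τ => σ τ / τ) (𝓝[>] 0) (𝓝 0))
    (p p' : ℝ) (hp : 1 ≤ p) (hp' : 1 ≤ p')
    (ω : Measure (S × A)) [IsProbabilityMeasure ω] :
    Tendsto (fun τ => integratedWasserstein p p' ω
        (M.returnDist (M.decoupledPolicy πref τ (σ τ)))
        (M.returnDist (MDP.filteredPolicy πref (M.qRef πref))))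
      (𝓝[>] 0) (𝓝 0) ∧
    (M.qStar = M.qRef πref →
      Tendsto (fun τ => integratedWasserstein p p' ω
          (M.returnDist (M.decoupledPolicy πref τ (σ τ)))
          (M.returnDist (MDP.filteredPolicy πref M.qStar)))
        (𝓝[>] 0) (𝓝 0)) := by
  have h := M.tendsto_integratedWasserstein_returnDist (l := 𝓝[>] (0 : ℝ))
    (fun τ => M.decoupledPolicy πref τ (σ τ)) (MDP.filteredPolicy πref (M.qRef πref))
    (M.tvTendsto_decoupledPolicy πref hcov σ hσpos hσ) (zero_lt_one.trans_le hp)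
    (zero_lt_one.trans_le hp') ω
  refine ⟨h, fun hq => ?_⟩
  simp only [hq]
  exact h
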